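/- Let $m\ge 2$ and $n\ge 0$ be integers, $M=m-2n$, and $h>0$. Consider $m$ commuting variables $x_1,\dots,x_m$ and $2n$ anticommuting variables $\theta_1,\dots,\theta_{2n}$, the latter generating the real Grassmann algebra $\mathfrak G_{2n}$. The super-hyperboloid of revolution $SH^{m|2n}_h$ of half height $h$ is given by the phase function $$g=\sum_{j=1}^{m-1}x_j^2-x_m^2-\sum_{j=1}^n\theta_{2j-1}\theta_{2j}-1=g_0+\mathbf g$$ (with $g_0$ the part of degree $0$ in the $\theta_j$ and $\mathbf g$ the nilpotent part) and the restriction $-h\le x_m\le h$. Its surface area is the non-oriented surface integral of the constant function $1$, $$\mathrm{area}(SH^{m|2n}_h)=\int_{\mathbb R^m}\int_B \delta(g)\,\bigl|\partial_{\mathbf x}[g]\bigr|\,H(h-x_m)\,H(h+x_m)\,dx_1\cdots dx_m ,$$ where $\delta(g)=\sum_{j=0}^n\frac{\mathbf g^j}{j!}\,\delta^{(j)}(g_0)$, $\delta^{(j)}(g_0)$ is the pull-back of the distribution $\delta^{(j)}$ on $\mathbb R$ along $g_0$, $H$ is the Heaviside function and $\int_B=\pi^{-n}\partial_{\theta_{2n}}\cdots\partial_{\theta_1}$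 is the Berezin integral. Here $$\partial_{\mathbf x}=2\sum_{j=1}^n\bigl(e'_{2j}\partial_{\theta_{2j-1}}-e'_{2j-1}\partial_{\theta_{2j}}\bigr)-\sum_{j=1}^m e_j\partial_{x_j}$$ is the super Dirac operator, where the generators $e_j,e'_k$ commute with all variables and satisfy $e_je_k+e_ke_j=-2\delta_{jk}$, $e_je'_k+e'_ke_j=0$, $e'_{2j-1}e'_{2k}-e'_{2k}e'_{2j-1}=\delta_{jk}$ and $e'_{2j}e'_{2k}-e'_{2k}e'_{2j}=e'_{2j-1}e'_{2k-1}-e'_{2k-1}e'_{2j-1}=0$; and $|\mathbf v|=(-\mathbf v^2)^{1/2}$ for a supervector $\mathbf v$, with powers of an even element $a=a_0+\mathbf a$ of positive body $a_0$ defined by Taylor expansion about $a_0$. Then this integral is well defined and $$\mathrm{area}(SH^{m|2n}_h)=\begin{cases}\dfrac{4h\,\pi^{\frac{M-1}{2}}}{\Gamma\left(\frac{M-1}{2}\right)}\,F_1\left(\tfrac12;-\tfrac12,\tfrac{3-M}{2};\tfrac32;-2h^2,-h^2\right), & M\notin\{1,-1,-3,\dots\},\\[2mm] 0, & M\in\{1,-1,-3,\dots\}.\end{cases}$$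 Here $F_1$ is Appell's first hypergeometric function $$F_1(a;b_1,b_2;c;z_1,z_2)=\sum_{j,k=0}^\infty\frac{(a)_{j+k}(b_1)_j(b_2)_k}{(c)_{j+k}\,j!\,k!}z_1^jz_2^k\qquad(|z_1|,|z_2|<1),$$ continued holomorphically to $z_1,z_2\in\mathbb C\setminus[1,\infty)$; that this continuation exists for the parameters above is part of the claim. -/

import Mathlib

open scoped ContDiff Topology

noncomputable section

namespace SuperAnalysis

/-! ### The Grassmann algebra and the Berezin integral -/

/-- The real Grassmann algebra with `2 n` anticommuting generators. -/
abbrev Grassmann (n : ℕ) : Type := ExteriorAlgebra ℝ (Fin (2 * n) → ℝ)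

/-- The fermionic variables (numbered from `0`). -/
def theta {n : ℕ} (i : Fin (2 * n)) : Grassmann n :=
  ExteriorAlgebra.ι ℝ (Pi.single i (1 : ℝ))

/-- The ordered monomial, the product of the `theta i` for `i` in `A` in increasing order. -/
def thetaMon {n : ℕ} (A : Finset (Fin (2 * n))) : Grassmann n :=
  ((A.sort (fun a b => a ≤ b)).map theta).prod

/-- The (left) fermionic partial derivative: the endomorphism `D` with `D 1 = 0` and
`D (theta k * b) = δ i k • b - theta k * D b`. -/
def fermionicDeriv {n : ℕ} (i : Fin (2 * n)) : Grassmann n →ₗ[ℝ] Grassmann n :=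
  CliffordAlgebra.contractLeft (Q := (0 : QuadraticForm ℝ (Fin (2 * n) → ℝ)))
    (LinearMap.proj i : (Fin (2 * n) → ℝ) →ₗ[ℝ] ℝ)

/-- The component of degree zero. -/
def body {n : ℕ} (a : Grassmann n) : ℝ := ExteriorAlgebra.algebraMapInv a

/-- The nilpotent part. -/
def nilPart {n : ℕ} (a : Grassmann n) : Grassmann n := a - algebraMap ℝ _ (body a)

/-- The Berezin integral `π⁻ⁿ ∂_{2n} ⋯ ∂_1` (the derivative of lowest index acts first;
the result of the `2 n` derivatives is a scalar). -/
def berezin {n : ℕ} (a : Grassmann n) : ℝ :=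
  (Real.pi ^ n)⁻¹ * body ((List.finRange (2 * n)).foldl (fun b i => fermionicDeriv i b) a)

/-- The real power `a ^ p` of an even element with positive body, through the Taylor expansion
`∑_{j ≤ n} (a - a₀)^j / j! * (-1)^j (-p)_j a₀^(p-j)`. -/
def grPow {n : ℕ} (p : ℝ) (a : Grassmann n) : Grassmann n :=
  ∑ j ∈ Finset.range (n + 1),
    (((-1) ^ j * (ascPochhammer ℝ j).eval (-p) * body a ^ (p - (j : ℝ)) / (j.factorial : ℝ)) : ℝ) •
      nilPart a ^ j

/-! ### Supervectors

A supervector is `∑ v_j e_j + ∑ w_j e'_j`, with `m` even coefficients `v_j`, `2 n` odd coefficients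
`w_j`, orthogonal Clifford generators `e_j` and symplectic Clifford generators `e'_j`. -/

/-- Position of the first fermionic variable of the `j`-th pair. -/
def fstIdx {n : ℕ} (j : Fin n) : Fin (2 * n) := ⟨2 * j.1, by omega⟩

/-- Position of the second fermionic variable of the `j`-th pair. -/
def sndIdx {n : ℕ} (j : Fin n) : Fin (2 * n) := ⟨2 * j.1 + 1, by omega⟩

/-- The square of a supervector, a Grassmann element by the Clifford relations
(see `superVector_sq`). -/
def vecSq {m n : ℕ} (v : Fin m → Grassmann n) (w : Fin (2 * n) → Grassmann n) : Grassmann n :=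
  -∑ j, v j ^ 2 + ∑ j : Fin n, w (fstIdx j) * w (sndIdx j)

/-- The absolute value `(-X²)^(1/2)` of a supervector `X`. -/
def vecAbs {m n : ℕ} (v : Fin m → Grassmann n) (w : Fin (2 * n) → Grassmann n) : Grassmann n :=
  grPow (1 / 2) (-vecSq v w)

/-- The symplectic form of the commutators of the generators `e'_j`. -/
def symplForm {n : ℕ} (j k : Fin (2 * n)) : ℝ :=
  if j.1 % 2 = 0 ∧ k.1 = j.1 + 1 then 1 else if k.1 % 2 = 0 ∧ j.1 = k.1 + 1 then -1 else 0

/-- Sums over the fermionic indices can be taken pair by pair. -/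
theorem sum_pairs {n : ℕ} {A : Type*} [AddCommMonoid A] (F : Fin (2 * n) → A) :
    ∑ i, F i = ∑ j : Fin n, (F (fstIdx j) + F (sndIdx j)) := by
  have h := Fintype.sum_equiv (finProdFinEquiv.trans (finCongr (Nat.mul_comm n 2)))
    (fun p : Fin n × Fin 2 => F (finProdFinEquiv.trans (finCongr (Nat.mul_comm n 2)) p)) F
    (fun _ => rfl)
  rw [← h, Fintype.sum_prod_type]
  refine Finset.sum_congr rfl fun j _ => ?_
  rw [Fin.sum_univ_two]
  congr 2 <;> ext <;> simp [fstIdx, sndIdx, finProdFinEquiv, add_comm]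

/-- `vecSq` is the square of the supervector in every algebra that contains the Grassmann algebra
and Clifford generators commuting with it. -/
theorem superVector_sq {m n : ℕ} {A : Type*} [Ring A] [Algebra ℝ A]
    (φ : Grassmann n →ₐ[ℝ] A) (e : Fin m → A) (f : Fin (2 * n) → A)
    (hee : ∀ j k, e j * e k + e k * e j = if j = k then -2 else 0)
    (hef : ∀ j k, e j * f k + f k * e j = 0)
    (hff : ∀ j k, f j * f k - f k * f j = algebraMap ℝ A (symplForm j k))
    (hφe : ∀ a j, φ a * e j = e j * φ a) (hφf : ∀ a j, φ a * f j = f j * φ a)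
    (v : Fin m → Grassmann n) (w : Fin (2 * n) → Grassmann n)
    (hvv : ∀ j k, v j * v k = v k * v j) (hvw : ∀ j k, v j * w k = w k * v j)
    (hww : ∀ j k, w j * w k = -(w k * w j)) :
    (∑ j, φ (v j) * e j + ∑ j, φ (w j) * f j) ^ 2 = φ (vecSq v w) := by
  have two_cancel : ∀ a b : A, a + a = b + b → a = b := fun a b hab => by
    have : (2 : ℝ) • a = (2 : ℝ) • b := by rw [two_smul, two_smul, hab]
    exact smul_right_injective A (two_ne_zero (α := ℝ)) this
  have swap : ∀ (a b : Grassmann n) (x y : A), φ b * x = x * φ b →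
      φ a * x * (φ b * y) = φ (a * b) * (x * y) := fun a b x y hx => by
    rw [map_mul, mul_assoc, ← mul_assoc x, ← hx]; simp only [mul_assoc]
  have hP : (∑ j, φ (v j) * e j) * (∑ j, φ (v j) * e j) = φ (-∑ j, v j ^ 2) := by
    apply two_cancel
    have h1 : (∑ j, φ (v j) * e j) * (∑ j, φ (v j) * e j)
        = ∑ j, ∑ k, φ (v j * v k) * (e j * e k) := by
      rw [Finset.sum_mul_sum]
      exact Finset.sum_congr rfl fun j _ => Finset.sum_congr rfl fun k _ => swap _ _ _ _ (hφe _ _)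
    have h2 : (∑ j, φ (v j) * e j) * (∑ j, φ (v j) * e j)
        = ∑ j, ∑ k, φ (v j * v k) * (e k * e j) := by
      rw [h1, Finset.sum_comm]
      exact Finset.sum_congr rfl fun j _ => Finset.sum_congr rfl fun k _ => by rw [hvv]
    nth_rewrite 1 [h1]
    rw [h2, ← Finset.sum_add_distrib, ← map_add, ← neg_add, ← Finset.sum_add_distrib, map_neg,
      map_sum, ← Finset.sum_neg_distrib]
    refine Finset.sum_congr rfl fun j _ => ?_
    rw [← Finset.sum_add_distrib]
    simp only [← mul_add, hee, mul_ite, mul_zero, Finset.sum_ite_eq, Finset.mem_univ, if_true]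
    rw [map_add, pow_two]
    noncomm_ring
  have hQ : (∑ j, φ (w j) * f j) * (∑ j, φ (w j) * f j)
      = φ (∑ j : Fin n, w (fstIdx j) * w (sndIdx j)) := by
    apply two_cancel
    have h1 : (∑ j, φ (w j) * f j) * (∑ j, φ (w j) * f j)
        = ∑ j, ∑ k, φ (w j * w k) * (f j * f k) := by
      rw [Finset.sum_mul_sum]
      exact Finset.sum_congr rfl fun j _ => Finset.sum_congr rfl fun k _ => swap _ _ _ _ (hφf _ _)
    have h2 : (∑ j, φ (w j) * f j) * (∑ j, φ (w j) * f j)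
        = ∑ j, ∑ k, -(φ (w j * w k) * (f k * f j)) := by
      rw [h1, Finset.sum_comm]
      refine Finset.sum_congr rfl fun j _ => Finset.sum_congr rfl fun k _ => ?_
      rw [hww, map_neg, neg_mul]
    have h3 : ∀ j : Fin (2 * n), (∑ k, φ (w j * w k) * algebraMap ℝ A (symplForm j k))
        = if hj : j.1 % 2 = 0 then φ (w j * w ⟨j.1 + 1, by omega⟩)
          else -φ (w j * w ⟨j.1 - 1, by omega⟩) := by
      intro j
      split_ifs with hj
      · rw [Finset.sum_eq_single ⟨j.1 + 1, by omega⟩]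
        · simp [symplForm, hj]
        · intro k _ hk
          have hk' : k.1 ≠ j.1 + 1 := fun hh => hk (Fin.ext hh)
          have h0 : symplForm j k = 0 := by
            unfold symplForm
            rw [if_neg (by omega), if_neg (by omega)]
          simp [h0]
        · simp
      · rw [Finset.sum_eq_single ⟨j.1 - 1, by omega⟩]
        · have h0 : symplForm j ⟨j.1 - 1, by omega⟩ = -1 := by
            unfold symplForm
            rw [if_neg (by dsimp only; omega), if_pos (by dsimp only; omega)]
          simp [h0]
        · intro k _ hk
          have hk' : k.1 ≠ j.1 - 1 := fun hh => hk (Fin.ext hh)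
          have h0 : symplForm j k = 0 := by
            unfold symplForm
            rw [if_neg (by omega), if_neg (by omega)]
          simp [h0]
        · simp
    nth_rewrite 1 [h1]
    rw [h2, ← Finset.sum_add_distrib]
    simp only [← Finset.sum_add_distrib, ← sub_eq_add_neg, ← mul_sub, hff, h3]
    rw [sum_pairs, map_sum, ← Finset.sum_add_distrib]
    refine Finset.sum_congr rfl fun j _ => ?_
    have ha : (fstIdx j).1 % 2 = 0 := by simp [fstIdx]
    have hb : ¬ (sndIdx j).1 % 2 = 0 := by simp only [sndIdx]; omega
    rw [dif_pos ha, dif_neg hb]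
    have hc : (⟨(sndIdx j).1 - 1, by omega⟩ : Fin (2 * n)) = fstIdx j := by
      ext; simp [fstIdx, sndIdx]
    rw [hc, hww (sndIdx j), map_neg, neg_neg]
    rfl
  have hPQ : (∑ j, φ (v j) * e j) * (∑ j, φ (w j) * f j)
      + (∑ j, φ (w j) * f j) * (∑ j, φ (v j) * e j) = 0 := by
    rw [Finset.sum_mul_sum, Finset.sum_mul_sum, Finset.sum_comm (γ := Fin m),
      ← Finset.sum_add_distrib]
    refine Finset.sum_eq_zero fun k _ => ?_
    rw [← Finset.sum_add_distrib]
    refine Finset.sum_eq_zero fun j _ => ?_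
    rw [swap _ _ _ _ (hφe _ _), swap _ _ _ _ (hφf _ _), hvw, ← mul_add, hef, mul_zero]
  rw [pow_two, add_mul, mul_add, mul_add, hP, hQ, vecSq, map_add]
  rw [add_assoc, ← add_assoc (_ * _) (_ * _), hPQ, zero_add]

/-! ### Superfunctions -/

/-- Superfunctions `∑_A F_A(x) θ_A` in `m` bosonic and `2 n` fermionic variables,
given by their coefficient functions. -/
abbrev SuperFun (m n : ℕ) : Type := Finset (Fin (2 * n)) → EuclideanSpace ℝ (Fin m) → ℝ

namespace SuperFun

variable {m n : ℕ}

/-- The value of a superfunction at a point, an element of the Grassmann algebra. -/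
def val (F : SuperFun m n) (x : EuclideanSpace ℝ (Fin m)) : Grassmann n :=
  ∑ A, F A x • thetaMon A

/-- The superfunction of class `C^k`. -/
def IsContDiff (k : ℕ∞) (F : SuperFun m n) : Prop := ∀ A, ContDiff ℝ k (F A)

/-- Even superfunctions. -/
def IsEven (F : SuperFun m n) : Prop := ∀ A, Odd A.card → F A = 0

/-- The bosonic partial derivative. -/
def bosonicDeriv (j : Fin m) (F : SuperFun m n) : SuperFun m n :=
  fun A x => fderiv ℝ (F A) x (EuclideanSpace.single j 1)

/-- The value at `x` of `|∂_X[F]|` for the left super Dirac operator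
`∂_X = 2 ∑_j (e'_{2j} ∂_{θ_{2j-1}} - e'_{2j-1} ∂_{θ_{2j}}) - ∑_j e_j ∂_{x_j}`. -/
def absGrad (F : SuperFun m n) (x : EuclideanSpace ℝ (Fin m)) : Grassmann n :=
  vecAbs (fun j => -(bosonicDeriv j F).val x)
    (fun i => if h : i.1 % 2 = 0
      then -((2 : ℝ) • fermionicDeriv ⟨i.1 + 1, by omega⟩ (F.val x))
      else (2 : ℝ) • fermionicDeriv ⟨i.1 - 1, by omega⟩ (F.val x))

end SuperFun

/-! ### Distributions and surface integrals -/

/-- The Heaviside function. -/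
def heaviside (t : ℝ) : ℝ := if 0 ≤ t then 1 else 0

/-- `⟨δ⁽ᵏ⁾(g₀), f⟩ = L`. The distribution `δ⁽ᵏ⁾(g₀)` is the pull-back of `δ⁽ᵏ⁾` along `g₀`: the limit
of `ρ_ε⁽ᵏ⁾ ∘ g₀` as `ρ_ε = ε⁻¹ ρ(·/ε)` tends to `δ`, whatever the smooth compactly supported `ρ` of
integral one. The function `f` may contain Heaviside factors. -/
def HasDeltaPairing {m : ℕ} (k : ℕ) (g₀ f : EuclideanSpace ℝ (Fin m) → ℝ) (L : ℝ) : Prop :=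
  ∀ ρ : ℝ → ℝ, ContDiff ℝ ∞ ρ → HasCompactSupport ρ → ∫ t, ρ t = 1 →
    Filter.Tendsto
      (fun ε : ℝ => ∫ x, iteratedDeriv k (fun t => ε⁻¹ * ρ (t / ε)) (g₀ x) * f x)
      (𝓝[>] 0) (𝓝 L)

theorem HasDeltaPairing.unique {m k : ℕ} {g₀ f : EuclideanSpace ℝ (Fin m) → ℝ} {L L' : ℝ}
    (h : HasDeltaPairing k g₀ f L) (h' : HasDeltaPairing k g₀ f L') : L = L' := by
  let b : ContDiffBump (0 : ℝ) := ⟨1, 2, one_pos, one_lt_two⟩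
  have h1 := b.contDiff_normed (μ := MeasureTheory.volume) (n := ⊤)
  have h2 := b.hasCompactSupport_normed (μ := MeasureTheory.volume)
  have h3 := b.integral_normed (μ := MeasureTheory.volume)
  exact tendsto_nhds_unique (h _ h1 h2 h3) (h' _ h1 h2 h3)

/-- The phase functions `g` (of a surface) and `c ∈ C` (purely bosonic, of the domains that the
surface is intersected with) are smooth, `g` is even, the bodies have no critical point on their
zero sets, and the part of the real surface `g₀ = 0` that is selected is compact. -/
structure IsAdmissible {m n : ℕ} (g : SuperFun m n)
    (C : List (EuclideanSpace ℝ (Fin m) → ℝ)) : Prop where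
  smooth : g.IsContDiff ⊤
  even : g.IsEven
  regular : ∀ x, g ∅ x = 0 → fderiv ℝ (g ∅) x ≠ 0
  smooth_constraint : ∀ c ∈ C, ContDiff ℝ ∞ c
  regular_constraint : ∀ c ∈ C, ∀ x, c x = 0 → fderiv ℝ c x ≠ 0
  compact : IsCompact {x | g ∅ x = 0 ∧ ∀ c ∈ C, c x ≤ 0}

/-- `I` is the non-oriented surface integral of `F` over the surface with phase function `g`
intersected with the domains `c ≤ 0` for `c ∈ C`, that is, the integral over superspace of
`δ(g) |∂_X[g]| ∏_c H(-c) F` where `δ(g) = ∑_{j ≤ n} 𝐠^j / j! δ⁽ʲ⁾(g₀)`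
and `𝐠` is the nilpotent part of `g`. -/
def HasSurfaceIntegral {m n : ℕ} (g : SuperFun m n)
    (C : List (EuclideanSpace ℝ (Fin m) → ℝ)) (F : SuperFun m n) (I : ℝ) : Prop :=
  IsAdmissible g C ∧ F.IsContDiff n ∧
    ∃ L : ℕ → ℝ,
      (∀ j ≤ n, HasDeltaPairing j (g ∅)
        (fun x => (C.map fun c => heaviside (-c x)).prod *
          berezin (((j.factorial : ℝ)⁻¹ • nilPart (g.val x) ^ j) * g.absGrad x * F.val x))
        (L j)) ∧
      I = ∑ j ∈ Finset.range (n + 1), L j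

theorem HasSurfaceIntegral.unique {m n : ℕ} {g : SuperFun m n}
    {C : List (EuclideanSpace ℝ (Fin m) → ℝ)} {F : SuperFun m n} {I I' : ℝ}
    (h : HasSurfaceIntegral g C F I) (h' : HasSurfaceIntegral g C F I') : I = I' := by
  obtain ⟨-, -, L, hL, rfl⟩ := h
  obtain ⟨-, -, L', hL', rfl⟩ := h'
  refine Finset.sum_congr rfl fun j hj => ?_
  have hj' : j ≤ n := Nat.lt_succ_iff.mp (Finset.mem_range.mp hj)
  exact (hL j hj').unique (hL' j hj')

/-! ### The super-hyperboloid of revolution -/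

/-- The index of the last bosonic variable. -/
def lastIdx (m : ℕ) (hm : 2 ≤ m) : Fin m := ⟨m - 1, by omega⟩

/-- The phase function `∑_{j < m} x_j² - x_m² - ∑_j θ_{2j-1} θ_{2j} - 1`. -/
def hyperboloidPhase (m n : ℕ) (hm : 2 ≤ m) : SuperFun m n :=
  Pi.single ∅ (fun x => ∑ j ∈ Finset.univ.erase (lastIdx m hm), x j ^ 2
      - x (lastIdx m hm) ^ 2 - 1)
    - ∑ j : Fin n, Pi.single {fstIdx j, sndIdx j} 1

/-- The phase functions of the constraints `x_m ≤ h` and `-h ≤ x_m`. -/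
def heightConstraints (m : ℕ) (hm : 2 ≤ m) (h : ℝ) : List (EuclideanSpace ℝ (Fin m) → ℝ) :=
  [fun x => x (lastIdx m hm) - h, fun x => -h - x (lastIdx m hm)]

/-- `S` is the surface area of the super-hyperboloid of revolution of half height `h`:
the surface integral of the constant superfunction `1`. -/
def IsAreaSH (m n : ℕ) (hm : 2 ≤ m) (h S : ℝ) : Prop :=
  HasSurfaceIntegral (hyperboloidPhase m n hm) (heightConstraints m hm h) (Pi.single ∅ 1) S

/-! ### Appell's hypergeometric function -/

/-- `Φ` is the principal branch of Appell's function `F₁(a; b₁, b₂; c; ·, ·)`: it is holomorphic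
where neither variable lies in `[1, ∞)`, and the sum of the double series on the unit bidisc. -/
def IsAppellF1 (a b₁ b₂ c : ℂ) (Φ : ℂ × ℂ → ℂ) : Prop :=
  DifferentiableOn ℂ Φ {z | 1 - z.1 ∈ Complex.slitPlane ∧ 1 - z.2 ∈ Complex.slitPlane} ∧
  ∀ z : ℂ × ℂ, ‖z.1‖ < 1 → ‖z.2‖ < 1 →
    HasSum (fun p : ℕ × ℕ =>
      (ascPochhammer ℂ (p.1 + p.2)).eval a * (ascPochhammer ℂ p.1).eval b₁ *
        (ascPochhammer ℂ p.2).eval b₂ /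
        ((ascPochhammer ℂ (p.1 + p.2)).eval c * (p.1.factorial : ℂ) * (p.2.factorial : ℂ)) *
        z.1 ^ p.1 * z.2 ^ p.2) (Φ z)

/-- Appell's hypergeometric function `F₁(a; b₁, b₂; c; z₁, z₂)` for `z₁, z₂ ∉ [1, ∞)`. -/
def appellF1 (a b₁ b₂ c z₁ z₂ : ℂ) : ℂ := Classical.epsilon (IsAppellF1 a b₁ b₂ c) (z₁, z₂)

end SuperAnalysis

end

noncomputable section
namespace SuperAnalysis

/-! ### The Grassmann algebra -/

section GrassmannAlgebra

variable {n : ℕ}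

/-! Put `Θ = ∑ θ_{2j-1} θ_{2j}`. The phase function is `g₀ - Θ` and minus the square of its Dirac
gradient is `4 (|x|² - Θ)`, so the whole integrand is a polynomial in `Θ`. The Berezin integral sees
only `Θ ^ n`, on which it equals `n! / π ^ n` (`berezin_thetaSum_pow`). What remains is a sum over
`j` of `δ⁽ʲ⁾(g₀)` paired with `binom(n, j)` times the falling factorial of `1/2` of order `n - j`
times `(|x|²) ^ (1/2 - (n - j))`, up to a common constant (`berezin_area_integrand`).

Let `t = x_m`, let `u` be the squared norm of the other coordinates and `c = u - t² - 1` the value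
of `g₀`. Then `|x|² = 1 + 2t² + c`, and polar coordinates give the density `u ^ b` with `u = 1 + t²
+ c` and `b = (m - 3) / 2`. Thus `δ⁽ʲ⁾(g₀)` produces `(-d/dc)^j` at `c = 0` of the integral of `(1 +
2t² + c) ^ a (1 + t² + c) ^ b` over `[-h, h]` (`hasDeltaPairing_phaseBody`).

On functions of the exponents `(a, b)`, `d/dc` acts as `A + B`, where the commuting operators `A =
lowerFst` and `B = lowerSnd` differentiate one factor each. The Taylor coefficients of the gradient
supply `A ^ (n - j)`, and the binomial theorem gives `∑ binom(n, j) A ^ (n - j) (-(A + B)) ^ j =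
(-B) ^ n` (`sum_choose_lower_apply`). Hence only the second factor is differentiated: its exponent
drops to `b - n = (M - 3) / 2`, with the falling factorial of `b` in front. Divided by `Γ(b + 1)`
this is `1 / Γ((M - 1) / 2)` (`fallingCoeff_div_Gamma`), unless `b` is one of `0, …, n - 1`, where
it vanishes; these are the exceptional `M`.

The remaining height integral is, after `t = h s`, Euler's integral for `F₁` with `a = 1/2`, `c =
3/2`. That integral is holomorphic on the whole domain and has the right double series, so it is the
continuation (`isAppellF1_appellIntegral`), which is unique there (`IsAppellF1.eqOn`). -/

theorem thetaMon_empty : thetaMon (∅ : Finset (Fin (2 * n))) = 1 := by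
  simp [thetaMon]

theorem fstIdx_lt_sndIdx (j : Fin n) : fstIdx j < sndIdx j := by
  simp [fstIdx, sndIdx, Fin.lt_def]

/-- The quadratic monomial of the `j`-th pair of fermionic variables. -/
def thetaPair (j : Fin n) : Grassmann n := theta (fstIdx j) * theta (sndIdx j)

theorem thetaMon_pair (j : Fin n) : thetaMon {fstIdx j, sndIdx j} = thetaPair j := by
  have h : ({fstIdx j, sndIdx j} : Finset (Fin (2 * n))).sort (fun a b => a ≤ b)
      = [fstIdx j, sndIdx j] := by
    rw [Finset.sort_insert]
    · simp
    · simpa using (fstIdx_lt_sndIdx j).le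
    · simpa using (fstIdx_lt_sndIdx j).ne
  simp [thetaMon, h, thetaPair]

theorem theta_mul_self (i : Fin (2 * n)) : theta i * theta i = (0 : Grassmann n) :=
  ExteriorAlgebra.ι_sq_zero _

theorem theta_mul_theta_comm (i k : Fin (2 * n)) :
    theta i * theta k = -(theta k * theta i : Grassmann n) :=
  eq_neg_of_add_eq_zero_left (ExteriorAlgebra.ι_add_mul_swap _ _)

theorem body_theta (i : Fin (2 * n)) : body (theta i) = 0 := by
  simp [body, theta, ExteriorAlgebra.algebraMapInv]

theorem body_mul (a b : Grassmann n) : body (a * b) = body a * body b := map_mul _ _ _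

theorem body_pow (a : Grassmann n) (k : ℕ) : body (a ^ k) = body a ^ k := map_pow _ _ _

theorem body_add (a b : Grassmann n) : body (a + b) = body a + body b := map_add _ _ _

theorem body_neg (a : Grassmann n) : body (-a) = -body a := map_neg _ _

theorem body_smul (c : ℝ) (a : Grassmann n) : body (c • a) = c * body a := map_smul _ _ _

theorem body_sum {ι : Type*} (s : Finset ι) (f : ι → Grassmann n) :
    body (∑ i ∈ s, f i) = ∑ i ∈ s, body (f i) := map_sum _ _ _

theorem body_algebraMap (c : ℝ) : body (algebraMap ℝ (Grassmann n) c) = c := by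
  simp [body]

theorem thetaPair_mul_self (j : Fin n) : thetaPair j * thetaPair j = 0 := by
  unfold thetaPair
  rw [mul_assoc, ← mul_assoc (theta (sndIdx j)), theta_mul_theta_comm (sndIdx j), neg_mul,
    mul_assoc, theta_mul_self]
  simp

theorem theta_commute_thetaPair (i : Fin (2 * n)) (j : Fin n) :
    Commute (theta i) (thetaPair j) := by
  unfold thetaPair Commute SemiconjBy
  rw [← mul_assoc, theta_mul_theta_comm i, neg_mul, mul_assoc, theta_mul_theta_comm i,
    mul_neg, neg_neg, mul_assoc]

theorem thetaPair_commute (i j : Fin n) : Commute (thetaPair i) (thetaPair j) :=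
  (theta_commute_thetaPair _ j).mul_left (theta_commute_thetaPair _ j)

/-! ### Fermionic derivatives of the pairs and of powers of their sums -/

theorem fermionicDeriv_one (i : Fin (2 * n)) : fermionicDeriv i (1 : Grassmann n) = 0 :=
  CliffordAlgebra.contractLeft_one (Q := (0 : QuadraticForm ℝ (Fin (2 * n) → ℝ))) _

theorem fermionicDeriv_algebraMap (i : Fin (2 * n)) (c : ℝ) :
    fermionicDeriv i (algebraMap ℝ (Grassmann n) c) = 0 :=
  CliffordAlgebra.contractLeft_algebraMap (0 : QuadraticForm ℝ (Fin (2 * n) → ℝ)) _ _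

theorem fermionicDeriv_theta_mul (i k : Fin (2 * n)) (b : Grassmann n) :
    fermionicDeriv i (theta k * b)
      = (if i = k then b else 0) - theta k * fermionicDeriv i b := by
  have := CliffordAlgebra.contractLeft_ι_mul (Q := (0 : QuadraticForm ℝ (Fin (2 * n) → ℝ)))
    (d := (LinearMap.proj i : (Fin (2 * n) → ℝ) →ₗ[ℝ] ℝ)) (Pi.single k (1 : ℝ)) b
  refine this.trans ?_
  simp only [LinearMap.proj_apply, Pi.single_apply, ite_smul, one_smul, zero_smul]
  rfl

theorem fermionicDeriv_theta (i k : Fin (2 * n)) :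
    fermionicDeriv i (theta k : Grassmann n) = if i = k then 1 else 0 := by
  simpa [fermionicDeriv_one] using fermionicDeriv_theta_mul i k 1

theorem fstIdx_ne_sndIdx (j k : Fin n) : fstIdx j ≠ sndIdx k := by
  simp only [fstIdx, sndIdx, ne_eq, Fin.mk.injEq]; omega

theorem fstIdx_inj {j k : Fin n} : fstIdx j = fstIdx k ↔ j = k := by
  simp only [fstIdx, Fin.ext_iff]; omega

theorem sndIdx_inj {j k : Fin n} : sndIdx j = sndIdx k ↔ j = k := by
  simp only [sndIdx, Fin.ext_iff]; omega

theorem fermionicDeriv_fst_thetaPair (j k : Fin n) :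
    fermionicDeriv (fstIdx j) (thetaPair k) = if j = k then theta (sndIdx k) else 0 := by
  rw [thetaPair, fermionicDeriv_theta_mul, fermionicDeriv_theta, if_neg (fstIdx_ne_sndIdx j k)]
  simp [fstIdx_inj]

theorem fermionicDeriv_snd_thetaPair (j k : Fin n) :
    fermionicDeriv (sndIdx j) (thetaPair k) = if j = k then -theta (fstIdx k) else 0 := by
  rw [thetaPair, fermionicDeriv_theta_mul, fermionicDeriv_theta,
    if_neg (fstIdx_ne_sndIdx k j).symm]
  simp only [sndIdx_inj]
  split_ifs <;> simp

theorem fermionicDeriv_thetaPair_mul {i : Fin (2 * n)} {k : Fin n} (h1 : i ≠ fstIdx k)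
    (h2 : i ≠ sndIdx k) (b : Grassmann n) :
    fermionicDeriv i (thetaPair k * b) = thetaPair k * fermionicDeriv i b := by
  rw [thetaPair, mul_assoc, fermionicDeriv_theta_mul, fermionicDeriv_theta_mul, if_neg h1,
    if_neg h2]
  simp [mul_assoc]

/-- The sum of the quadratic monomials of the pairs from the `j`-th one on. -/
def thetaTail (j : ℕ) : Grassmann n := ∑ k ∈ Finset.univ.filter (fun k : Fin n => j ≤ k.1), thetaPair k

/-- The variable differentiated belongs to a pair before the `j`-th, so it does not occur in the
tail. The even pairs let the derivative pass without a sign. -/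
theorem fermionicDeriv_thetaTail_pow {i : Fin (2 * n)} {j : ℕ} (hi : i.1 < 2 * j) (N : ℕ) :
    fermionicDeriv i (thetaTail j ^ N : Grassmann n) = 0 := by
  have key : ∀ b : Grassmann n,
      fermionicDeriv i (thetaTail j * b) = thetaTail j * fermionicDeriv i b := by
    intro b
    simp only [thetaTail, Finset.sum_mul, map_sum]
    refine Finset.sum_congr rfl fun k hk => fermionicDeriv_thetaPair_mul ?_ ?_ b
    all_goals
      have hk' : j ≤ k.1 := by simpa using hk
      simp only [ne_eq, Fin.ext_iff, fstIdx, sndIdx]; omega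
  induction N with
  | zero => simp [fermionicDeriv_one]
  | succ N ih => rw [pow_succ', key, ih, mul_zero]

theorem thetaTail_eq_add {j : ℕ} (hj : j < n) :
    (thetaTail j : Grassmann n) = thetaPair ⟨j, hj⟩ + thetaTail (j + 1) := by
  have : Finset.univ.filter (fun k : Fin n => j ≤ k.1)
      = insert ⟨j, hj⟩ (Finset.univ.filter (fun k : Fin n => j + 1 ≤ k.1)) := by
    ext k; simp [Fin.ext_iff]; omega
  rw [thetaTail, this, Finset.sum_insert (by simp)]; rfl

theorem add_pow_of_sq_eq_zero {R : Type*} [Ring R] {a b : R} (hab : Commute a b) (ha : a * a = 0)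
    (N : ℕ) : (a + b) ^ N = b ^ N + N • (a * b ^ (N - 1)) := by
  induction N with
  | zero => simp
  | succ N ih =>
    rw [pow_succ', ih, add_mul, mul_add, mul_add, mul_smul_comm, ← mul_assoc a a, ha, zero_mul,
      smul_zero, add_zero, mul_smul_comm, ← mul_assoc b a, ← hab.eq, mul_assoc, ← pow_succ']
    -- The truncated exponent `N - 1` makes the first step separate: there the extra term carries
    -- the coefficient `0`.
    rcases N with _ | N
    · simp [add_comm]
    · simp only [Nat.add_sub_cancel, ← pow_succ', succ_nsmul]
      abel

/-- The pair `p` squares to zero, so `(p + T) ^ N = T ^ N + N p T ^ (N - 1)`. The two derivatives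
kill the first term and strip `p` from the second; taking the lower index first gives the sign `+1`.
-/
theorem fermionicDeriv_pair_thetaTail_pow {j : ℕ} (hj : j < n) (N : ℕ) :
    fermionicDeriv (sndIdx ⟨j, hj⟩) (fermionicDeriv (fstIdx ⟨j, hj⟩) (thetaTail j ^ N))
      = (N : ℝ) • (thetaTail (j + 1) ^ (N - 1) : Grassmann n) := by
  have hf : ∀ N, fermionicDeriv (fstIdx ⟨j, hj⟩) (thetaTail (j + 1) ^ N : Grassmann n) = 0 :=
    fermionicDeriv_thetaTail_pow (by simp only [fstIdx]; omega)
  have hs : ∀ N, fermionicDeriv (sndIdx ⟨j, hj⟩) (thetaTail (j + 1) ^ N : Grassmann n) = 0 :=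
    fermionicDeriv_thetaTail_pow (by simp only [sndIdx]; omega)
  have hc : Commute (thetaPair ⟨j, hj⟩) (thetaTail (j + 1) : Grassmann n) :=
    Commute.sum_right _ _ _ fun k _ => thetaPair_commute _ k
  rw [thetaTail_eq_add hj, add_pow_of_sq_eq_zero hc (thetaPair_mul_self _), map_add, hf,
    map_nsmul, thetaPair, mul_assoc, fermionicDeriv_theta_mul, if_pos rfl, fermionicDeriv_theta_mul,
    if_neg (fstIdx_ne_sndIdx _ _), hf]
  simp only [mul_zero, sub_zero, zero_add]
  rw [map_nsmul, fermionicDeriv_theta_mul, if_pos rfl, hs, mul_zero, sub_zero, Nat.cast_smul_eq_nsmul]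

theorem foldl_take_fermionicDeriv (N : ℕ) {j : ℕ} (hj : j ≤ n) :
    ((List.finRange (2 * n)).take (2 * j)).foldl (fun b i => fermionicDeriv i b)
        (thetaTail 0 ^ N : Grassmann n)
      = (N.descFactorial j : ℝ) • thetaTail j ^ (N - j) := by
  induction j with
  | zero => simp
  | succ j ih =>
    have hj' : j < n := hj
    have h1 : 2 * j < (List.finRange (2 * n)).length := by simp; omega
    have h2 : 2 * j + 1 < (List.finRange (2 * n)).length := by simp; omega
    rw [show 2 * (j + 1) = 2 * j + 1 + 1 by ring, List.take_add_one, List.take_add_one,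
      List.getElem?_eq_getElem h1, List.getElem?_eq_getElem h2, List.foldl_append,
      List.foldl_append, ih hj'.le]
    simp only [Option.toList_some, List.foldl_cons, List.foldl_nil, map_smul]
    have e1 : (List.finRange (2 * n))[2 * j] = fstIdx ⟨j, hj'⟩ := by simp [fstIdx]
    have e2 : (List.finRange (2 * n))[2 * j + 1] = sndIdx ⟨j, hj'⟩ := by simp [sndIdx]
    rw [e1, e2, fermionicDeriv_pair_thetaTail_pow, smul_smul, Nat.descFactorial_succ]
    congr 1
    push_cast
    exact mul_comm _ _

/-- The sum of all quadratic monomials `θ_{2j-1} θ_{2j}`. -/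
def thetaSum : Grassmann n := ∑ j : Fin n, thetaPair j

theorem thetaTail_zero : (thetaTail 0 : Grassmann n) = thetaSum := by
  simp [thetaTail, thetaSum]

theorem body_thetaSum : body (thetaSum : Grassmann n) = 0 := by
  simp [thetaSum, body_sum, thetaPair, body_mul, body_theta]

/-- After all `n` pairs the tail is empty. For `N < n` the descending factorial vanishes; for `N >
n` a positive power of the zero tail is left. -/
theorem berezin_thetaSum_pow (N : ℕ) :
    berezin (thetaSum ^ N : Grassmann n)
      = if N = n then (Real.pi ^ n)⁻¹ * (n.factorial : ℝ) else 0 := by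
  have h := foldl_take_fermionicDeriv (n := n) N le_rfl
  rw [List.take_of_length_le (by simp), thetaTail_zero] at h
  have h0 : (thetaTail n : Grassmann n) = 0 := by
    rw [thetaTail, Finset.filter_false_of_mem, Finset.sum_empty]
    intro k _; omega
  rw [berezin, h, h0, body_smul, body_pow]
  split_ifs with hN
  · subst hN
    simp [body, Nat.descFactorial_self]
  · rcases Nat.lt_or_gt_of_ne hN with hlt | hgt
    · simp [Nat.descFactorial_of_lt hlt]
    · have : N - n ≠ 0 := by omega
      simp [body, this]

/-- The Berezin integral as a linear form. -/
theorem exists_berezin_linearMap : ∃ B : Grassmann n →ₗ[ℝ] ℝ, ∀ a, B a = berezin a := by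
  have key : ∀ l : List (Fin (2 * n)), ∃ T : Grassmann n →ₗ[ℝ] Grassmann n,
      ∀ a, T a = l.foldl (fun b i => fermionicDeriv i b) a := by
    intro l
    induction l with
    | nil => exact ⟨LinearMap.id, fun a => rfl⟩
    | cons i l ih =>
      obtain ⟨T, hT⟩ := ih
      exact ⟨T ∘ₗ fermionicDeriv i, fun a => hT _⟩
  obtain ⟨T, hT⟩ := key (List.finRange (2 * n))
  refine ⟨(Real.pi ^ n)⁻¹ • (ExteriorAlgebra.algebraMapInv.toLinearMap ∘ₗ T), fun a => ?_⟩
  simp [berezin, body, hT]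

theorem berezin_sum_smul_pow (c : ℕ → ℝ) (s : Finset ℕ) (j : ℕ) :
    berezin (thetaSum ^ j * ∑ k ∈ s, c k • thetaSum ^ k : Grassmann n)
      = ∑ k ∈ s, c k * if j + k = n then (Real.pi ^ n)⁻¹ * (n.factorial : ℝ) else 0 := by
  obtain ⟨B, hB⟩ := exists_berezin_linearMap (n := n)
  rw [← hB, Finset.mul_sum, map_sum]
  refine Finset.sum_congr rfl fun k _ => ?_
  rw [mul_smul_comm, map_smul, ← pow_add, hB, berezin_thetaSum_pow, smul_eq_mul]

end GrassmannAlgebra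

/-! ### The phase function of the super-hyperboloid -/

namespace SuperFun

variable {m n : ℕ}

theorem val_sub (F G : SuperFun m n) (x : EuclideanSpace ℝ (Fin m)) :
    (F - G).val x = F.val x - G.val x := by
  simp [val, sub_smul]

theorem val_sum {ι : Type*} (s : Finset ι) (F : ι → SuperFun m n) (x : EuclideanSpace ℝ (Fin m)) :
    (∑ i ∈ s, F i).val x = ∑ i ∈ s, (F i).val x := by
  simp only [val, Finset.sum_apply, Finset.sum_smul]
  exact Finset.sum_comm

theorem val_single (A : Finset (Fin (2 * n))) (f : EuclideanSpace ℝ (Fin m) → ℝ)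
    (x : EuclideanSpace ℝ (Fin m)) :
    SuperFun.val (Pi.single A f : SuperFun m n) x = f x • thetaMon A := by
  rw [val, Finset.sum_eq_single A]
  · simp
  · intro B _ hB
    simp [Pi.single_eq_of_ne hB]
  · simp

end SuperFun

section Hyperboloid

variable {m : ℕ} (n : ℕ) (hm : 2 ≤ m)

/-- The body of the phase function of the super-hyperboloid. -/
def phaseBody (x : EuclideanSpace ℝ (Fin m)) : ℝ :=
  ∑ j ∈ Finset.univ.erase (lastIdx m hm), x j ^ 2 - x (lastIdx m hm) ^ 2 - 1

theorem hyperboloidPhase_empty : hyperboloidPhase m n hm ∅ = phaseBody hm := by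
  have : ∀ j : Fin n, (Pi.single {fstIdx j, sndIdx j} 1 : SuperFun m n) ∅ = 0 := fun j =>
    Pi.single_eq_of_ne (Finset.insert_ne_empty _ _).symm _
  rw [hyperboloidPhase, Pi.sub_apply, Finset.sum_apply, Finset.sum_eq_zero fun j _ => this j,
    sub_zero, Pi.single_eq_same]
  rfl

/-- Only the body depends on `x`, so bosonic derivatives annihilate all other coefficients. -/
theorem hyperboloidPhase_of_ne {A : Finset (Fin (2 * n))} (hA : A ≠ ∅) :
    ∃ c : ℝ, hyperboloidPhase m n hm A = fun _ => c := by
  refine ⟨-∑ j : Fin n, if A = {fstIdx j, sndIdx j} then 1 else 0, ?_⟩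
  ext x
  simp only [hyperboloidPhase, Pi.sub_apply, Finset.sum_apply, Pi.single_eq_of_ne hA,
    Pi.zero_apply, zero_sub, neg_inj]
  refine Finset.sum_congr rfl fun j _ => ?_
  rw [Pi.single_apply]
  split_ifs <;> rfl

theorem val_hyperboloidPhase (x : EuclideanSpace ℝ (Fin m)) :
    (hyperboloidPhase m n hm).val x = algebraMap ℝ _ (phaseBody hm x) - thetaSum := by
  rw [hyperboloidPhase, SuperFun.val_sub, SuperFun.val_sum, SuperFun.val_single, thetaMon_empty,
    Algebra.algebraMap_eq_smul_one, thetaSum]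
  congr 1
  refine Finset.sum_congr rfl fun j _ => ?_
  rw [SuperFun.val_single, thetaMon_pair, Pi.one_apply, one_smul]

theorem nilPart_val_hyperboloidPhase (x : EuclideanSpace ℝ (Fin m)) :
    nilPart ((hyperboloidPhase m n hm).val x) = -thetaSum := by
  rw [nilPart, val_hyperboloidPhase, sub_eq_add_neg (algebraMap _ _ _), body_add, body_algebraMap,
    body_neg, body_thetaSum]
  simp

theorem phaseBody_eq_sum (x : EuclideanSpace ℝ (Fin m)) :
    phaseBody hm x = ∑ j, (if j = lastIdx m hm then -1 else 1) * x j ^ 2 - 1 := by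
  rw [phaseBody, ← Finset.add_sum_erase _ _ (Finset.mem_univ (lastIdx m hm)), if_pos rfl]
  have h : ∀ j ∈ Finset.univ.erase (lastIdx m hm),
      x j ^ 2 = (if j = lastIdx m hm then -1 else 1) * x j ^ 2 := fun j hj => by
    rw [if_neg (Finset.ne_of_mem_erase hj), one_mul]
  rw [Finset.sum_congr rfl h]
  ring

theorem hasFDerivAt_phaseBody (x : EuclideanSpace ℝ (Fin m)) :
    HasFDerivAt (phaseBody hm)
      (∑ j, ((if j = lastIdx m hm then -1 else 1) * (2 * x j)) •
        (EuclideanSpace.proj j : EuclideanSpace ℝ (Fin m) →L[ℝ] ℝ)) x := by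
  rw [show phaseBody hm = _ from funext (phaseBody_eq_sum hm)]
  refine HasFDerivAt.sub_const _ (HasFDerivAt.fun_sum fun j _ => ?_)
  have h := ((EuclideanSpace.proj j : EuclideanSpace ℝ (Fin m) →L[ℝ] ℝ).hasFDerivAt (x := x)).pow 2
  refine (h.const_mul (if j = lastIdx m hm then (-1 : ℝ) else 1)).congr_fderiv ?_
  rw [smul_smul]
  simp

theorem fderiv_phaseBody_single (x : EuclideanSpace ℝ (Fin m)) (k : Fin m) :
    fderiv ℝ (phaseBody hm) x (EuclideanSpace.single k 1)
      = (if k = lastIdx m hm then -1 else 1) * (2 * x k) := by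
  rw [(hasFDerivAt_phaseBody hm x).fderiv, sum_apply, Finset.sum_eq_single k]
  · change _ * (EuclideanSpace.single k (1 : ℝ) : EuclideanSpace ℝ (Fin m)) k = _
    rw [PiLp.single_apply, if_pos rfl, mul_one]
  · intro j _ hj
    change _ * (EuclideanSpace.single k (1 : ℝ) : EuclideanSpace ℝ (Fin m)) j = _
    rw [PiLp.single_apply, if_neg hj, mul_zero]
  · simp

theorem contDiff_phaseBody : ContDiff ℝ ∞ (phaseBody hm) := by
  unfold phaseBody
  have h : ∀ j : Fin m, ContDiff ℝ ∞ fun x : EuclideanSpace ℝ (Fin m) => x j := fun j =>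
    (EuclideanSpace.proj j : EuclideanSpace ℝ (Fin m) →L[ℝ] ℝ).contDiff
  exact ((ContDiff.sum fun j _ => (h j).pow 2).sub ((h _).pow 2)).sub contDiff_const

theorem val_bosonicDeriv_hyperboloidPhase (x : EuclideanSpace ℝ (Fin m)) (k : Fin m) :
    (SuperFun.bosonicDeriv k (hyperboloidPhase m n hm)).val x
      = algebraMap ℝ _ ((if k = lastIdx m hm then -1 else 1) * (2 * x k)) := by
  have : SuperFun.bosonicDeriv k (hyperboloidPhase m n hm)
      = Pi.single ∅ fun x => (if k = lastIdx m hm then -1 else 1) * (2 * x k) := by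
    funext A
    by_cases hA : A = ∅
    · subst hA
      rw [Pi.single_eq_same]
      funext y
      rw [SuperFun.bosonicDeriv, hyperboloidPhase_empty, fderiv_phaseBody_single]
    · rw [Pi.single_eq_of_ne hA]
      obtain ⟨c, hc⟩ := hyperboloidPhase_of_ne n hm hA
      funext y
      rw [SuperFun.bosonicDeriv, hc]
      simp
  rw [this, SuperFun.val_single, thetaMon_empty, Algebra.algebraMap_eq_smul_one]

theorem fermionicDeriv_fst_hyperboloidPhase (x : EuclideanSpace ℝ (Fin m)) (j : Fin n) :
    fermionicDeriv (fstIdx j) ((hyperboloidPhase m n hm).val x) = -theta (sndIdx j) := by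
  rw [val_hyperboloidPhase, map_sub, fermionicDeriv_algebraMap, thetaSum, map_sum,
    Finset.sum_congr rfl fun k _ => fermionicDeriv_fst_thetaPair j k]
  simp

theorem fermionicDeriv_snd_hyperboloidPhase (x : EuclideanSpace ℝ (Fin m)) (j : Fin n) :
    fermionicDeriv (sndIdx j) ((hyperboloidPhase m n hm).val x) = theta (fstIdx j) := by
  rw [val_hyperboloidPhase, map_sub, fermionicDeriv_algebraMap, thetaSum, map_sum,
    Finset.sum_congr rfl fun k _ => fermionicDeriv_snd_thetaPair j k]
  simp

/-- The coefficient `a (a - 1) ⋯ (a - k + 1)` of the Taylor expansion of a power. -/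
def fallingCoeff (k : ℕ) (a : ℝ) : ℝ := (-1) ^ k * (ascPochhammer ℝ k).eval (-a)

/-- The bosonic components square to `4 x_j²` whatever the sign of the coordinate in `g₀`. The
fermionic components are `-2 θ_i`, so each pair contributes `-4 θ_{2j-1} θ_{2j}` to minus the
square. The rest is the Taylor expansion of the square root. -/
theorem absGrad_hyperboloidPhase (x : EuclideanSpace ℝ (Fin m)) :
    (hyperboloidPhase m n hm).absGrad x
      = ∑ k ∈ Finset.range (n + 1), (fallingCoeff k (1 / 2) * (4 * ‖x‖ ^ 2) ^ (1 / 2 - (k : ℝ))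
          / (k.factorial : ℝ) * (-4) ^ k) • thetaSum ^ k := by
  have hsq : ∀ w : Fin (2 * n) → Grassmann n,
      (∀ j, w (fstIdx j) = -((2 : ℝ) • theta (fstIdx j))) →
      (∀ j, w (sndIdx j) = -((2 : ℝ) • theta (sndIdx j))) →
      -vecSq (fun j => -(SuperFun.bosonicDeriv j (hyperboloidPhase m n hm)).val x) w
        = algebraMap ℝ _ (4 * ‖x‖ ^ 2) + (-4 : ℝ) • thetaSum := by
    intro w h1 h2
    rw [vecSq, neg_add, neg_neg, EuclideanSpace.real_norm_sq_eq, Finset.mul_sum, map_sum]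
    congr 1
    · refine Finset.sum_congr rfl fun j _ => ?_
      rw [val_bosonicDeriv_hyperboloidPhase, neg_sq, ← map_pow, mul_pow]
      congr 1
      split_ifs <;> ring
    · rw [thetaSum, Finset.smul_sum, ← Finset.sum_neg_distrib]
      refine Finset.sum_congr rfl fun j _ => ?_
      rw [h1, h2, neg_mul_neg, smul_mul_smul_comm, ← neg_smul, thetaPair]
      norm_num
  rw [SuperFun.absGrad, vecAbs, hsq]
  · have hb : body (algebraMap ℝ (Grassmann n) (4 * ‖x‖ ^ 2) + (-4 : ℝ) • thetaSum)
        = 4 * ‖x‖ ^ 2 := by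
      rw [body_add, body_algebraMap, body_smul, body_thetaSum, mul_zero, add_zero]
    rw [grPow]
    refine Finset.sum_congr rfl fun k _ => ?_
    rw [nilPart, hb, add_sub_cancel_left, smul_pow, smul_smul, fallingCoeff]
  · intro j
    have h : (fstIdx j).1 % 2 = 0 := by simp [fstIdx]
    rw [dif_pos h, show (⟨(fstIdx j).1 + 1, by simp only [fstIdx]; omega⟩ : Fin (2 * n)) = sndIdx j from rfl,
      fermionicDeriv_snd_hyperboloidPhase]
  · intro j
    have h : ¬ (sndIdx j).1 % 2 = 0 := by simp only [sndIdx]; omega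
    rw [dif_neg h, show (⟨(sndIdx j).1 - 1, by omega⟩ : Fin (2 * n)) = fstIdx j from rfl,
      fermionicDeriv_fst_hyperboloidPhase, smul_neg]

/-- The Berezin integral of the coefficient of `δ⁽ʲ⁾(g₀)` in the area integral. -/
theorem berezin_area_integrand (x : EuclideanSpace ℝ (Fin m)) {j : ℕ} (hj : j ≤ n) :
    berezin (((j.factorial : ℝ)⁻¹ • nilPart ((hyperboloidPhase m n hm).val x) ^ j)
        * (hyperboloidPhase m n hm).absGrad x * SuperFun.val (Pi.single ∅ 1 : SuperFun m n) x)
      = 2 * (-1) ^ n * (Real.pi ^ n)⁻¹ * (n.choose j * fallingCoeff (n - j) (1 / 2))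
        * (‖x‖ ^ 2) ^ (1 / 2 - ((n - j : ℕ) : ℝ)) := by
  rw [SuperFun.val_single, thetaMon_empty, Pi.one_apply, one_smul, mul_one,
    nilPart_val_hyperboloidPhase, absGrad_hyperboloidPhase, neg_pow, smul_mul_assoc, mul_assoc]
  obtain ⟨B, hB⟩ := exists_berezin_linearMap (n := n)
  have hs : ∀ y : Grassmann n, (-1) ^ j * y = ((-1 : ℝ) ^ j) • y := fun y => by
    rw [Algebra.smul_def, map_pow, map_neg, map_one]
  -- With `Θ ^ j` already present, only the Taylor term of order `n - j` reaches the top degree.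
  rw [hs, ← hB, map_smul, map_smul, hB, berezin_sum_smul_pow, Finset.sum_eq_single (n - j)]
  -- The factor `4 ^ (1/2 - (n - j))` cancels against `(-4) ^ (n - j)` up to `2` and a sign, and the
  -- factorials combine to the binomial coefficient.
  · rw [if_pos (by omega), Nat.choose_eq_factorial_div_factorial hj,
      Nat.cast_div (Nat.factorial_mul_factorial_dvd_factorial hj) (by positivity),
      Real.mul_rpow (by norm_num) (by positivity), Real.rpow_sub (by norm_num : (0 : ℝ) < 4),
      Real.rpow_natCast, show (4 : ℝ) ^ (1 / 2 : ℝ) = 2 by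
        rw [show (4 : ℝ) = 2 ^ (2 : ℝ) by norm_num, ← Real.rpow_mul (by norm_num)]; norm_num,
      neg_pow (4 : ℝ)]
    have hn : (-1 : ℝ) ^ n = (-1) ^ j * (-1) ^ (n - j) := by rw [← pow_add]; congr 1; omega
    rw [hn]
    have h4 : (4 : ℝ) ^ (n - j) ≠ 0 := by positivity
    have hf1 : (j.factorial : ℝ) ≠ 0 := by positivity
    have hf2 : ((n - j).factorial : ℝ) ≠ 0 := by positivity
    simp only [smul_eq_mul]
    push_cast
    field_simp
  · intro k _ hk
    rw [if_neg (by omega), mul_zero]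
  · intro h
    exact absurd (Finset.mem_range.mpr (by omega)) h

theorem isAdmissible_hyperboloid (h : ℝ) :
    IsAdmissible (hyperboloidPhase m n hm) (heightConstraints m hm h) where
  smooth A := by
    by_cases hA : A = ∅
    · rw [hA, hyperboloidPhase_empty]
      exact contDiff_phaseBody hm
    · obtain ⟨c, hc⟩ := hyperboloidPhase_of_ne n hm hA
      rw [hc]
      exact contDiff_const
  even A hA := by
    have h1 : A ≠ ∅ := by rintro rfl; simp at hA
    have h2 : ∀ j : Fin n, A ≠ {fstIdx j, sndIdx j} := by
      rintro j rfl
      rw [Finset.card_pair (fstIdx_ne_sndIdx j j)] at hA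
      exact absurd hA (by decide)
    simp [hyperboloidPhase, h1, h2]
  regular x hx h0 := by
    rw [hyperboloidPhase_empty] at hx h0
    have : ∀ k, x k = 0 := fun k => by
      have := fderiv_phaseBody_single hm x k
      rw [h0, zero_apply, eq_comm, mul_eq_zero] at this
      have h2 : (if k = lastIdx m hm then (-1 : ℝ) else 1) ≠ 0 := by split_ifs <;> norm_num
      simpa [h2] using this
    -- The only critical point is the origin, where the body is `-1`.
    simp [phaseBody, this] at hx
  smooth_constraint c hc := by
    have h : ContDiff ℝ ∞ fun x : EuclideanSpace ℝ (Fin m) => x (lastIdx m hm) :=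
      (EuclideanSpace.proj (lastIdx m hm) : EuclideanSpace ℝ (Fin m) →L[ℝ] ℝ).contDiff
    simp only [heightConstraints, List.mem_cons, List.not_mem_nil, or_false] at hc
    rcases hc with rfl | rfl
    · exact h.sub contDiff_const
    · exact contDiff_const.sub h
  regular_constraint c hc x _ h0 := by
    have h := (EuclideanSpace.proj (lastIdx m hm) : EuclideanSpace ℝ (Fin m) →L[ℝ] ℝ).hasFDerivAt
      (x := x)
    simp only [heightConstraints, List.mem_cons, List.not_mem_nil, or_false] at hc
    have key : ∀ f : EuclideanSpace ℝ (Fin m) →L[ℝ] ℝ, f = 0 →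
        f (EuclideanSpace.single (lastIdx m hm) 1) = 0 := fun f hf => by simp [hf]
    rcases hc with rfl | rfl
    · simpa using key _ ((h.sub_const _).fderiv.symm.trans h0)
    · simpa using key _ ((h.const_sub _).fderiv.symm.trans h0)
  compact := by
    have hc : ∀ c ∈ heightConstraints m hm h, Continuous c := by
      intro c hc
      simp only [heightConstraints, List.mem_cons, List.not_mem_nil, or_false] at hc
      rcases hc with rfl | rfl <;> fun_prop
    refine Metric.isCompact_of_isClosed_isBounded ?_ ?_
    · rw [hyperboloidPhase_empty]
      refine (isClosed_eq (contDiff_phaseBody hm).continuous continuous_const).inter ?_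
      have hs : {x | ∀ c ∈ heightConstraints m hm h, c x ≤ 0}
          = ⋂ c ∈ heightConstraints m hm h, {x | c x ≤ 0} := by ext x; simp
      change IsClosed {x | ∀ c ∈ heightConstraints m hm h, c x ≤ 0}
      rw [hs]
      exact isClosed_biInter fun c hc' => isClosed_le (hc c hc') continuous_const
    -- On `g₀ = 0` one has `|x|² = 1 + 2 x_m²`, and the constraints give `x_m² ≤ h²`.
    · refine (Metric.isBounded_closedBall (x := 0) (r := Real.sqrt (1 + 2 * h ^ 2))).subset ?_
      rintro x ⟨hx, hx'⟩
      rw [hyperboloidPhase_empty, phaseBody] at hx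
      have h1 := hx' (fun x => x (lastIdx m hm) - h) (by simp [heightConstraints])
      have h2 := hx' (fun x => -h - x (lastIdx m hm)) (by simp [heightConstraints])
      simp only at h1 h2
      rw [mem_closedBall_zero_iff]
      apply Real.le_sqrt_of_sq_le
      rw [EuclideanSpace.real_norm_sq_eq, ← Finset.add_sum_erase _ _ (Finset.mem_univ (lastIdx m hm))]
      have : x (lastIdx m hm) ^ 2 ≤ h ^ 2 := sq_le_sq' (by linarith) (by linarith)
      linarith

end Hyperboloid

/-! ### The height integral of the hyperboloid -/

section HeightIntegral

open MeasureTheory Set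

/-- The operator `X ↦ ((a, b) ↦ a X(a - 1, b))`. -/
def lowerFst : Module.End ℝ (ℝ → ℝ → ℝ) where
  toFun X a b := a * X (a - 1) b
  map_add' X Y := by ext a b; simp [mul_add]
  map_smul' c X := by ext a b; simp; ring

/-- The operator `X ↦ ((a, b) ↦ b X(a, b - 1))`. -/
def lowerSnd : Module.End ℝ (ℝ → ℝ → ℝ) where
  toFun X a b := b * X a (b - 1)
  map_add' X Y := by ext a b; simp [mul_add]
  map_smul' c X := by ext a b; simp; ring

theorem lowerFst_apply (X : ℝ → ℝ → ℝ) (a b : ℝ) : lowerFst X a b = a * X (a - 1) b := rfl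

theorem lowerSnd_apply (X : ℝ → ℝ → ℝ) (a b : ℝ) : lowerSnd X a b = b * X a (b - 1) := rfl

theorem commute_lowerFst_lowerSnd : Commute lowerFst lowerSnd := by
  ext X a b
  simp only [Module.End.mul_apply, lowerFst_apply, lowerSnd_apply]
  ring

/-! ### Powers of the lowering operators and the binomial identity -/

theorem fallingCoeff_succ (k : ℕ) (a : ℝ) :
    fallingCoeff (k + 1) a = fallingCoeff k a * (a - k) := by
  rw [fallingCoeff, fallingCoeff, ascPochhammer_succ_eval, pow_succ]
  ring

theorem lowerFst_pow_apply (k : ℕ) (X : ℝ → ℝ → ℝ) (a b : ℝ) :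
    (lowerFst ^ k) X a b = fallingCoeff k a * X (a - k) b := by
  induction k generalizing X with
  | zero => simp [fallingCoeff]
  | succ k ih =>
    rw [pow_succ, Module.End.mul_apply, ih, lowerFst_apply, fallingCoeff_succ, mul_assoc, sub_sub]
    push_cast
    rfl

theorem neg_lowerSnd_pow_apply (k : ℕ) (X : ℝ → ℝ → ℝ) (a b : ℝ) :
    ((-lowerSnd) ^ k) X a b = (-1) ^ k * fallingCoeff k b * X a (b - k) := by
  induction k generalizing X with
  | zero => simp [fallingCoeff]
  | succ k ih =>
    have h : (-lowerSnd) X a (b - k) = -((b - k) * X a (b - k - 1)) := rfl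
    rw [pow_succ, Module.End.mul_apply, ih, h, fallingCoeff_succ, sub_sub]
    push_cast
    ring

/-- This is the binomial theorem for the commuting operators `-(A + B)` and `A`, whose sum is `-B`,
evaluated at `(a, b)`. It is the cancellation that makes the area a single integral. -/
theorem sum_choose_lower_apply (n : ℕ) (X : ℝ → ℝ → ℝ) (a b : ℝ) :
    ∑ j ∈ Finset.range (n + 1), (n.choose j * fallingCoeff (n - j) a) *
        ((-(lowerFst + lowerSnd)) ^ j) X (a - ((n - j : ℕ) : ℝ)) b
      = (-1) ^ n * fallingCoeff n b * X a (b - n) := by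
  have hc : Commute (-(lowerFst + lowerSnd)) lowerFst :=
    ((Commute.refl _).add_left commute_lowerFst_lowerSnd.symm).neg_left
  have h := hc.add_pow n
  rw [show -(lowerFst + lowerSnd) + lowerFst = -lowerSnd by abel] at h
  have h1 := congrArg (fun T : Module.End ℝ (ℝ → ℝ → ℝ) => T X a b) h
  simp only [LinearMap.sum_apply, Finset.sum_apply] at h1
  rw [← neg_lowerSnd_pow_apply, h1]
  refine Finset.sum_congr rfl fun j _ => ?_
  rw [(hc.pow_pow j (n - j)).eq, ← (Nat.cast_commute (n.choose j) _).eq,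
    Module.End.mul_apply, Module.End.mul_apply, mul_assoc, ← lowerFst_pow_apply,
    Module.End.natCast_apply, Pi.smul_apply, Pi.smul_apply, nsmul_eq_mul]

/-- The operator forms finite combinations of values at shifted exponents, so limits known at all
`(a, b)` pass through it. Only the undifferentiated delta sequence then needs analysis. -/
theorem tendsto_lower_pow {ι : Type*} {l : Filter ι} {X : ι → ℝ → ℝ → ℝ} {Y : ℝ → ℝ → ℝ}
    (h : ∀ a b, Filter.Tendsto (fun i => X i a b) l (𝓝 (Y a b))) (j : ℕ) (a b : ℝ) :
    Filter.Tendsto (fun i => ((-(lowerFst + lowerSnd)) ^ j) (X i) a b) l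
      (𝓝 (((-(lowerFst + lowerSnd)) ^ j) Y a b)) := by
  induction j generalizing X Y with
  | zero => exact h a b
  | succ j ih =>
    simp only [pow_succ, Module.End.mul_apply]
    exact ih fun a b => (((h _ _).const_mul a).add ((h _ _).const_mul b)).neg

/-- The integrand of the height integral near the surface; `c` is the value of the phase
function, cut off below. -/
def heightKernel (a b t c : ℝ) : ℝ :=
  (1 + 2 * t ^ 2 + max c (-3 / 4)) ^ a * (1 + t ^ 2 + max c (-3 / 4)) ^ b

/-- The cutoff at `-3/4` keeps both bases at least `1/4`, so real powers are continuous everywhere.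
It lies below `-1/2`, hence is inactive on the interval where the test functions live. -/
theorem continuous_heightKernel (a b : ℝ) :
    Continuous fun z : ℝ × ℝ => heightKernel a b z.1 z.2 := by
  have h : ∀ z : ℝ × ℝ, -3 / 4 ≤ max z.2 (-3 / 4) := fun z => le_max_right _ _
  refine Continuous.mul (Continuous.rpow_const (by fun_prop) fun z => Or.inl ?_)
    (Continuous.rpow_const (by fun_prop) fun z => Or.inl ?_)
  all_goals nlinarith [h z, sq_nonneg z.1]

/-- The pairing of a function of the value of the phase function with the height integrand. -/
def heightPairing (h : ℝ) (η : ℝ → ℝ) (a b : ℝ) : ℝ :=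
  ∫ t in -h..h, ∫ c in (-1 / 2 : ℝ)..(1 / 2), η c * heightKernel a b t c

theorem hasDerivAt_heightKernel (a b t : ℝ) {c : ℝ} (hc : -3 / 4 < c) :
    HasDerivAt (heightKernel a b t)
      (a * heightKernel (a - 1) b t c + b * heightKernel a (b - 1) t c) c := by
  have h1 : 0 < 1 + 2 * t ^ 2 + c := by nlinarith [sq_nonneg t]
  have h2 : 0 < 1 + t ^ 2 + c := by nlinarith [sq_nonneg t]
  have hd : HasDerivAt (fun c => (1 + 2 * t ^ 2 + c) ^ a * (1 + t ^ 2 + c) ^ b)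
      (a * heightKernel (a - 1) b t c + b * heightKernel a (b - 1) t c) c := by
    have e1 := ((hasDerivAt_id c).const_add (1 + 2 * t ^ 2)).rpow_const (p := a) (Or.inl h1.ne')
    have e2 := ((hasDerivAt_id c).const_add (1 + t ^ 2)).rpow_const (p := b) (Or.inl h2.ne')
    refine (e1.mul e2).congr_deriv ?_
    simp only [heightKernel, max_eq_left hc.le, id]
    ring
  refine hd.congr_of_eventuallyEq ?_
  filter_upwards [lt_mem_nhds hc] with c' hc'
  rw [heightKernel, max_eq_left hc'.le]

/-- Integration by parts in `c`: the boundary terms vanish because the support lies in the open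
interval, and the derivative of the kernel lowers one exponent at a time. -/
theorem heightPairing_deriv (h : ℝ) {η : ℝ → ℝ} (hη : ContDiff ℝ ∞ η)
    (hs : tsupport η ⊆ Ioo (-1 / 2) (1 / 2)) :
    heightPairing h (deriv η) = (-(lowerFst + lowerSnd)) (heightPairing h η) := by
  ext a b
  have hη0 := hη.continuous
  have hη1 : Continuous (deriv η) := hη.continuous_deriv (by simp)
  have hz : ∀ c, c ∉ Ioo (-1 / 2 : ℝ) (1 / 2) → η c = 0 := fun c hc =>
    image_eq_zero_of_notMem_tsupport fun hc' => hc (hs hc')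
  have hk : ∀ a b t, Continuous (heightKernel a b t) := fun a b t =>
    (continuous_heightKernel a b).comp (Continuous.prodMk_right t)
  have hint : ∀ a b, Continuous fun t => ∫ c in (-1 / 2 : ℝ)..(1 / 2), η c * heightKernel a b t c :=
    fun a b => intervalIntegral.continuous_parametric_intervalIntegral_of_continuous'
      (f := fun t c => η c * heightKernel a b t c)
      ((hη0.comp continuous_snd).mul (continuous_heightKernel a b)) _ _
  have key : ∀ t, ∫ c in (-1 / 2 : ℝ)..(1 / 2), deriv η c * heightKernel a b t c
      = -(a * ∫ c in (-1 / 2 : ℝ)..(1 / 2), η c * heightKernel (a - 1) b t c)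
        - b * ∫ c in (-1 / 2 : ℝ)..(1 / 2), η c * heightKernel a (b - 1) t c := by
    intro t
    have hmem : ∀ c ∈ uIcc (-1 / 2 : ℝ) (1 / 2), -3 / 4 < c := fun c hc => by
      rw [uIcc_of_le (by norm_num)] at hc
      linarith [hc.1]
    have := intervalIntegral.integral_mul_deriv_eq_deriv_mul
      (fun c hc => hasDerivAt_heightKernel a b t (hmem c hc))
      (fun c _ => ((hη.differentiable (by simp)) c).hasDerivAt)
      (Continuous.intervalIntegrable (by have := hk (a - 1) b t; have := hk a (b - 1) t; fun_prop) _ _)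
      (hη1.intervalIntegrable _ _)
    rw [hz (1 / 2) (by simp), hz (-1 / 2) (by simp), mul_zero, mul_zero, sub_zero, zero_sub] at this
    simp only [mul_comm (deriv η _)]
    rw [this, ← intervalIntegral.integral_const_mul, ← intervalIntegral.integral_const_mul,
      ← neg_add', neg_inj, ← intervalIntegral.integral_add]
    · congr 1
      ext c
      ring
    · exact Continuous.intervalIntegrable (by have := hk (a - 1) b t; fun_prop) _ _
    · exact Continuous.intervalIntegrable (by have := hk a (b - 1) t; fun_prop) _ _
  change heightPairing h (deriv η) a b
    = -(a * heightPairing h η (a - 1) b + b * heightPairing h η a (b - 1))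
  simp only [heightPairing, key]
  rw [intervalIntegral.integral_sub, intervalIntegral.integral_neg,
    intervalIntegral.integral_const_mul, intervalIntegral.integral_const_mul]
  · ring
  · exact Continuous.intervalIntegrable (by have := hint (a - 1) b; fun_prop) _ _
  · exact Continuous.intervalIntegrable (by have := hint a (b - 1); fun_prop) _ _

theorem heightPairing_iteratedDeriv (h : ℝ) (j : ℕ) {η : ℝ → ℝ} (hη : ContDiff ℝ ∞ η)
    (hs : tsupport η ⊆ Ioo (-1 / 2) (1 / 2)) :
    heightPairing h (iteratedDeriv j η)
      = ((-(lowerFst + lowerSnd)) ^ j) (heightPairing h η) := by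
  induction j generalizing η with
  | zero => simp
  | succ j ih =>
    rw [iteratedDeriv_succ', ih, heightPairing_deriv h hη hs, pow_succ, Module.End.mul_apply]
    · exact hη.deriv' 
    · exact (closure_minimal (support_deriv_subset) (isClosed_tsupport _)).trans hs

theorem tendsto_heightPairing {h : ℝ} {ρ : ℝ → ℝ} (hρ : Continuous ρ)
    (hρs : HasCompactSupport ρ) (hρ1 : ∫ t, ρ t = 1) (a b : ℝ) :
    Filter.Tendsto (fun ε : ℝ => heightPairing h (fun t => ε⁻¹ * ρ (t / ε)) a b) (𝓝[>] 0)
      (𝓝 (∫ t in -h..h, (1 + 2 * t ^ 2) ^ a * (1 + t ^ 2) ^ b)) := by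
  obtain ⟨R, hR0, hR⟩ : ∃ R, 0 < R ∧ ∀ t, R ≤ |t| → ρ t = 0 := by
    obtain ⟨R, hR⟩ := hρs.isCompact.isBounded.subset_ball 0
    refine ⟨max R 1, by positivity, fun t ht => image_eq_zero_of_notMem_tsupport fun hm => ?_⟩
    have := hR hm
    rw [mem_ball_zero_iff, Real.norm_eq_abs] at this
    linarith [le_max_left R 1]
  set q : ℝ → ℝ := fun c => ∫ t in -h..h, heightKernel a b t c with hq
  have hqc : Continuous q := intervalIntegral.continuous_parametric_intervalIntegral_of_continuous'
    (f := fun c t => heightKernel a b t c)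
    ((continuous_heightKernel a b).comp continuous_swap) _ _
  have hq0 : q 0 = ∫ t in -h..h, (1 + 2 * t ^ 2) ^ a * (1 + t ^ 2) ^ b := by
    have : max (0 : ℝ) (-3 / 4) = 0 := max_eq_left (by norm_num)
    simp [hq, heightKernel, this]
  have hset : ∀ f : ℝ → ℝ, (∀ v, R ≤ |v| → f v = 0) →
      ∫ v in Icc (-R) R, f v = ∫ v, f v := fun f hf =>
    setIntegral_eq_integral_of_forall_compl_eq_zero fun v hv => hf v <| by
      by_contra hlt
      exact hv (abs_le.mp (not_le.mp hlt).le)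
  -- After the substitution `c = ε v` the integral makes sense at `ε = 0` too, where it is `q 0`
  -- times the total mass of `ρ`; the limit is thus continuity in a parameter.
  have hcont : Continuous fun ε : ℝ => ∫ v in Icc (-R) R, ρ v * q (ε * v) :=
    continuous_parametric_integral_of_continuous (f := fun ε v => ρ v * q (ε * v))
      (by simp only [Function.uncurry_def]; fun_prop) isCompact_Icc
  have hlim := (hcont.tendsto 0).mono_left (nhdsWithin_le_nhds (s := Ioi 0))
  have h0 : ∫ v in Icc (-R) R, ρ v * q (0 * v) = q 0 := by
    simp only [zero_mul]
    rw [integral_mul_const, hset ρ hR, hρ1, one_mul]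
  rw [h0, hq0] at hlim
  refine hlim.congr' ?_
  -- For such `ε` the rescaled mollifier lives inside `[-1/2, 1/2]`, so the truncation of the
  -- `c`-integral loses nothing.
  have hmem : Ioo (0 : ℝ) (1 / (2 * R)) ∈ 𝓝[>] (0 : ℝ) := Ioo_mem_nhdsGT (by positivity)
  filter_upwards [hmem] with ε hε
  have hε0 : 0 < ε := hε.1
  have hεR : ε * R < 1 / 2 := by
    have := (lt_div_iff₀ (by positivity)).mp hε.2
    linarith
  have hz : ∀ c, c ∉ Ioc (-1 / 2 : ℝ) (1 / 2) → ρ (c / ε) = 0 := fun c hc => by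
    apply hR
    rw [abs_div, abs_of_pos hε0, le_div_iff₀ hε0]
    by_contra hlt
    have := abs_lt.mp ((not_le.mp hlt).trans (by linarith : R * ε < 1 / 2))
    exact hc ⟨by linarith [this.1], this.2.le⟩
  symm
  calc heightPairing h (fun t => ε⁻¹ * ρ (t / ε)) a b
      = ∫ c in (-1 / 2 : ℝ)..(1 / 2), ∫ t in -h..h, ε⁻¹ * ρ (c / ε) * heightKernel a b t c := by
        refine intervalIntegral_intervalIntegral_swap
          (F := fun t c => ε⁻¹ * ρ (c / ε) * heightKernel a b t c) ?_
        refine IntegrableOn.mono_set ?_ (prod_mono uIoc_subset_uIcc uIoc_subset_uIcc)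
        refine ContinuousOn.integrableOn_compact (isCompact_uIcc.prod isCompact_uIcc)
          (Continuous.continuousOn ?_)
        exact ((continuous_const.mul (hρ.comp (continuous_snd.div_const _))).mul
          (continuous_heightKernel a b))
    _ = ∫ c in (-1 / 2 : ℝ)..(1 / 2), ε⁻¹ * (ρ (c / ε) * q c) := by
        simp only [intervalIntegral.integral_const_mul, hq, mul_assoc]
    _ = ε⁻¹ * ∫ c, ρ (c / ε) * q (ε * (c / ε)) := by
        rw [intervalIntegral.integral_const_mul, intervalIntegral.integral_of_le (by norm_num),
          setIntegral_eq_integral_of_forall_compl_eq_zero]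
        · simp only [mul_div_cancel₀ _ hε0.ne']
        · intro c hc
          rw [hz c hc, zero_mul]
    _ = ∫ v, ρ v * q (ε * v) := by
        rw [Measure.integral_comp_div (fun v => ρ v * q (ε * v)), abs_of_pos hε0, smul_eq_mul,
          inv_mul_cancel_left₀ hε0.ne']
    _ = ∫ v in Icc (-R) R, ρ v * q (ε * v) :=
        (hset _ fun v hv => by rw [hR v hv, zero_mul]).symm

end HeightIntegral

/-! ### Integration over the level sets of the phase function -/

section SpaceIntegral

open MeasureTheory Set

/-- Polar coordinates and `u = r²`; the constant comes from `d` times the volume of the unit ball,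
halved by the substitution. -/
theorem integral_norm_sq {d : ℕ} (hd : 1 ≤ d) (f : ℝ → ℝ) :
    ∫ y : EuclideanSpace ℝ (Fin d), f (‖y‖ ^ 2)
      = Real.pi ^ ((d : ℝ) / 2) / Real.Gamma ((d : ℝ) / 2)
        * ∫ u in Ioi (0 : ℝ), u ^ ((d : ℝ) / 2 - 1) * f u := by
  have : Nonempty (Fin d) := ⟨⟨0, hd⟩⟩
  have hd0 : (0 : ℝ) < d := by exact_mod_cast hd
  have hball : (volume : Measure (EuclideanSpace ℝ (Fin d))).real (Metric.ball 0 1)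
      = Real.pi ^ ((d : ℝ) / 2) / ((d : ℝ) / 2 * Real.Gamma ((d : ℝ) / 2)) := by
    rw [measureReal_def, EuclideanSpace.volume_ball, ENNReal.ofReal_one, one_pow, one_mul,
      ENNReal.toReal_ofReal (by positivity), Fintype.card_fin, Real.Gamma_add_one (by positivity),
      Real.sqrt_eq_rpow, ← Real.rpow_natCast, ← Real.rpow_mul Real.pi_pos.le]
    ring_nf
  have hsub : ∫ u in Ioi (0 : ℝ), u ^ ((d : ℝ) / 2 - 1) * f u
      = 2 * ∫ r in Ioi (0 : ℝ), r ^ (d - 1) * f (r ^ 2) := by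
    rw [← integral_comp_rpow_Ioi_of_pos (p := 2) (by norm_num), ← integral_const_mul]
    refine setIntegral_congr_fun measurableSet_Ioi fun r hr => ?_
    have hr0 : 0 < r := hr
    have e1 : (r : ℝ) ^ (2 : ℝ) = r ^ 2 := by norm_cast
    have e2 : r ^ ((2 : ℝ) - 1) * (r ^ (2 : ℝ)) ^ ((d : ℝ) / 2 - 1) = r ^ (d - 1) := by
      rw [← Real.rpow_mul hr0.le, ← Real.rpow_add hr0, ← Real.rpow_natCast, Nat.cast_sub hd]
      congr 1
      push_cast
      ring
    simp only [smul_eq_mul]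
    rw [← e2, ← e1]
    ring
  rw [integral_fun_norm_addHaar volume (fun r => f (r ^ 2)), hball, hsub, finrank_euclideanSpace,
    Fintype.card_fin, nsmul_eq_mul, smul_eq_mul]
  simp only [smul_eq_mul]
  have hG : Real.Gamma ((d : ℝ) / 2) ≠ 0 := (Real.Gamma_pos_of_pos (by positivity)).ne'
  field_simp

theorem integral_last_norm_sq {d : ℕ} (G : ℝ → ℝ → ℝ)
    (hG : Integrable fun z : ℝ × EuclideanSpace ℝ (Fin d) => G z.1 (‖z.2‖ ^ 2)) :
    ∫ x : EuclideanSpace ℝ (Fin (d + 1)), G (x (Fin.last d)) (∑ j : Fin d, x j.castSucc ^ 2)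
      = ∫ t, ∫ y : EuclideanSpace ℝ (Fin d), G t (‖y‖ ^ 2) := by
  have h1 := EuclideanSpace.volume_preserving_symm_measurableEquiv_toLp (Fin (d + 1))
  have h2 := volume_preserving_piFinSuccAbove (fun _ : Fin (d + 1) => ℝ) (Fin.last d)
  have h3 := (MeasurePreserving.id (volume : Measure ℝ)).prod
    (EuclideanSpace.volume_preserving_symm_measurableEquiv_toLp (Fin d)).symm
  have h := (h3.comp h2).comp h1
  have hemb : MeasurableEmbedding ((Prod.map id (MeasurableEquiv.toLp 2 (Fin d → ℝ)).symm.symm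
      ∘ MeasurableEquiv.piFinSuccAbove (fun _ : Fin (d + 1) => ℝ) (Fin.last d))
      ∘ (MeasurableEquiv.toLp 2 (Fin (d + 1) → ℝ)).symm) :=
    ((((MeasurableEquiv.refl ℝ).prodCongr
      (MeasurableEquiv.toLp 2 (Fin d → ℝ)).symm.symm).measurableEmbedding).comp
      (MeasurableEquiv.measurableEmbedding _)).comp (MeasurableEquiv.measurableEmbedding _)
  have := h.integral_comp hemb (fun z : ℝ × EuclideanSpace ℝ (Fin d) => G z.1 (‖z.2‖ ^ 2))
  rw [← integral_prod _ hG]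
  refine Eq.trans ?_ this
  congr 1
  ext x
  simp only [EuclideanSpace.real_norm_sq_eq]
  simp [MeasurableEquiv.piFinSuccAbove, Fin.init]

/-- Since `heaviside 0 = 1`, both endpoints are included. -/
theorem heaviside_mul_heaviside (h t : ℝ) :
    heaviside (-(t - h)) * heaviside (-(-h - t)) = (Icc (-h) h).indicator 1 t := by
  by_cases ht : t ∈ Icc (-h) h
  · rw [indicator_of_mem ht, heaviside, heaviside, if_pos (by linarith [ht.2]),
      if_pos (by linarith [ht.1])]
    simp
  · rw [indicator_of_notMem ht]
    by_cases h1 : t ≤ h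
    · have h2 : t < -h := by
        by_contra h2
        exact ht ⟨not_lt.mp h2, h1⟩
      rw [heaviside, heaviside, if_neg (c := 0 ≤ -(-h - t)) (by linarith), mul_zero]
    · rw [heaviside, heaviside, if_neg (c := 0 ≤ -(t - h)) (by linarith), zero_mul]

/-- Translation by `t² + 1`. Where `η` does not vanish, `u > t² + 1/2 > 0`, so the half-line may be
replaced by the whole line and the cutoff is invisible. -/
theorem integral_Ioi_heightKernel {η : ℝ → ℝ} (hz : ∀ c, c ∉ Ioo (-1 / 2 : ℝ) (1 / 2) → η c = 0)
    (a b t : ℝ) :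
    ∫ u in Ioi (0 : ℝ), u ^ b * (η (u - t ^ 2 - 1) * (1 + 2 * t ^ 2 + max (u - t ^ 2 - 1) (-3 / 4)) ^ a)
      = ∫ c in (-1 / 2 : ℝ)..(1 / 2), η c * heightKernel a b t c := by
  have hz' : ∀ c, c ∉ Ioc (-1 / 2 : ℝ) (1 / 2) → η c = 0 := fun c hc =>
    hz c fun hc' => hc (Ioo_subset_Ioc_self hc')
  calc _ = ∫ u in Ioi (0 : ℝ), η (u - (t ^ 2 + 1)) * heightKernel a b t (u - (t ^ 2 + 1)) := by
        refine setIntegral_congr_fun measurableSet_Ioi fun u _ => ?_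
        simp only [sub_sub]
        by_cases hc : u - (t ^ 2 + 1) ∈ Ioo (-1 / 2 : ℝ) (1 / 2)
        · rw [heightKernel, max_eq_left (a := u - (t ^ 2 + 1)) (by linarith [hc.1]),
            show 1 + t ^ 2 + (u - (t ^ 2 + 1)) = u by ring]
          ring
        · rw [hz _ hc]; ring
    _ = ∫ u, η (u - (t ^ 2 + 1)) * heightKernel a b t (u - (t ^ 2 + 1)) := by
        refine setIntegral_eq_integral_of_forall_compl_eq_zero fun u hu => ?_
        rw [hz, zero_mul]
        have hu' : u ≤ 0 := not_lt.mp hu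
        intro hc
        nlinarith [hc.1, sq_nonneg t]
    _ = ∫ c, η c * heightKernel a b t c :=
        integral_sub_right_eq_self (fun c => η c * heightKernel a b t c) _
    _ = _ := by
        rw [intervalIntegral.integral_of_le (by norm_num),
          setIntegral_eq_integral_of_forall_compl_eq_zero]
        intro c hc
        rw [hz' c hc, zero_mul]

theorem integral_comp_phaseBody {m : ℕ} (hm : 2 ≤ m) {h : ℝ} (hh : 0 < h) {η : ℝ → ℝ}
    (hη : Continuous η) (hs : tsupport η ⊆ Ioo (-1 / 2) (1 / 2)) (C a : ℝ) :
    ∫ x : EuclideanSpace ℝ (Fin m), η (phaseBody hm x) *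
        (((heightConstraints m hm h).map fun c => heaviside (-c x)).prod * (C * (‖x‖ ^ 2) ^ a))
      = C * (Real.pi ^ (((m : ℝ) - 1) / 2) / Real.Gamma (((m : ℝ) - 1) / 2))
        * heightPairing h η a (((m : ℝ) - 3) / 2) := by
  obtain ⟨d, rfl⟩ : ∃ d, m = d + 1 := ⟨m - 1, by omega⟩
  have hd : 1 ≤ d := by omega
  have hz : ∀ c, c ∉ Ioo (-1 / 2 : ℝ) (1 / 2) → η c = 0 := fun c hc =>
    image_eq_zero_of_notMem_tsupport fun hc' => hc (hs hc')
  have hlast : lastIdx (d + 1) hm = Fin.last d := rfl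
  set g : ℝ → ℝ → ℝ := fun t u =>
    η (u - t ^ 2 - 1) * (1 + 2 * t ^ 2 + max (u - t ^ 2 - 1) (-3 / 4)) ^ a with hg
  have hgc : Continuous fun z : ℝ × ℝ => g z.1 z.2 := by
    refine Continuous.mul (by fun_prop) (Continuous.rpow_const (by fun_prop) fun z => Or.inl ?_)
    nlinarith [le_max_right (z.2 - z.1 ^ 2 - 1) (-3 / 4), sq_nonneg z.1]
  set G : ℝ → ℝ → ℝ := fun t u => (Icc (-h) h).indicator (fun t => g t u) t with hG
  have hGint : Integrable fun z : ℝ × EuclideanSpace ℝ (Fin d) => G z.1 (‖z.2‖ ^ 2) := by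
    -- On the slab, `η ≠ 0` forces `‖y‖² < t² + 3/2 ≤ h² + 3/2`, so this compact set carries the
    -- whole integrand and Fubini applies.
    have hK : IsCompact (Icc (-h) h ×ˢ Metric.closedBall (0 : EuclideanSpace ℝ (Fin d))
        (Real.sqrt (h ^ 2 + 2))) := isCompact_Icc.prod (isCompact_closedBall _ _)
    have hc : Continuous fun z : ℝ × EuclideanSpace ℝ (Fin d) => g z.1 (‖z.2‖ ^ 2) :=
      hgc.comp (by fun_prop : Continuous fun z : ℝ × EuclideanSpace ℝ (Fin d) => (z.1, ‖z.2‖ ^ 2))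
    have hi := (hc.continuousOn.integrableOn_compact (μ := volume) hK).integrable_indicator
      hK.measurableSet
    refine hi.congr (Filter.Eventually.of_forall fun z => ?_)
    by_cases hz1 : z.1 ∈ Icc (-h) h
    · by_cases hz2 : z.2 ∈ Metric.closedBall (0 : EuclideanSpace ℝ (Fin d)) (Real.sqrt (h ^ 2 + 2))
      · rw [indicator_of_mem (mk_mem_prod hz1 hz2), hG]
        simp only [indicator_of_mem hz1]
      · rw [indicator_of_notMem (fun hmem => hz2 hmem.2), hG]
        simp only [indicator_of_mem hz1, hg]
        rw [hz, zero_mul]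
        intro hc
        refine hz2 (mem_closedBall_zero_iff.mpr (Real.le_sqrt_of_sq_le ?_))
        have := sq_le_sq' hz1.1 hz1.2
        linarith [hc.2]
    · rw [indicator_of_notMem (fun hmem => hz1 hmem.1), hG]
      simp only [indicator_of_notMem hz1]
  have hphase : ∀ x : EuclideanSpace ℝ (Fin (d + 1)), phaseBody hm x
      = ∑ j : Fin d, x j.castSucc ^ 2 - x (Fin.last d) ^ 2 - 1 := fun x => by
    rw [phaseBody_eq_sum, Fin.sum_univ_castSucc, hlast]
    simp [(Fin.castSucc_lt_last _).ne, sub_eq_add_neg]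
  have hnorm : ∀ x : EuclideanSpace ℝ (Fin (d + 1)), ‖x‖ ^ 2
      = ∑ j : Fin d, x j.castSucc ^ 2 + x (Fin.last d) ^ 2 := fun x => by
    rw [EuclideanSpace.real_norm_sq_eq, Fin.sum_univ_castSucc]
  have hint : ∀ x : EuclideanSpace ℝ (Fin (d + 1)), η (phaseBody hm x) *
        (((heightConstraints (d + 1) hm h).map fun c => heaviside (-c x)).prod * (C * (‖x‖ ^ 2) ^ a))
      = C * G (x (Fin.last d)) (∑ j : Fin d, x j.castSucc ^ 2) := by
    intro x
    simp only [heightConstraints, List.map_cons, List.map_nil, List.prod_cons, List.prod_nil,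
      mul_one, heaviside_mul_heaviside, hlast, hphase, hnorm, hG]
    set t := x (Fin.last d)
    set u := ∑ j : Fin d, x j.castSucc ^ 2
    by_cases ht : t ∈ Icc (-h) h
    · rw [indicator_of_mem ht, indicator_of_mem ht, hg]
      by_cases hc : u - t ^ 2 - 1 ∈ Ioo (-1 / 2 : ℝ) (1 / 2)
      · simp only [max_eq_left (a := u - t ^ 2 - 1) (b := -3 / 4) (by linarith [hc.1])]
        rw [show 1 + 2 * t ^ 2 + (u - t ^ 2 - 1) = u + t ^ 2 by ring, Pi.one_apply]
        ring
      · simp only [hz _ hc]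
        ring
    · rw [indicator_of_notMem ht, indicator_of_notMem ht]
      ring
  simp only [hint]
  rw [integral_const_mul, integral_last_norm_sq G hGint, mul_assoc]
  congr 1
  have hinner : ∀ t, ∫ y : EuclideanSpace ℝ (Fin d), G t (‖y‖ ^ 2)
      = (Icc (-h) h).indicator (fun t => Real.pi ^ ((d : ℝ) / 2) / Real.Gamma ((d : ℝ) / 2)
        * ∫ c in (-1 / 2 : ℝ)..(1 / 2), η c * heightKernel a ((d : ℝ) / 2 - 1) t c) t := by
    intro t
    by_cases ht : t ∈ Icc (-h) h
    · simp only [hG, indicator_of_mem ht, hg]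
      rw [integral_norm_sq hd fun u =>
        η (u - t ^ 2 - 1) * (1 + 2 * t ^ 2 + max (u - t ^ 2 - 1) (-3 / 4)) ^ a,
        integral_Ioi_heightKernel hz]
    · simp only [hG, indicator_of_notMem ht, integral_zero]
  simp only [hinner]
  rw [integral_indicator measurableSet_Icc, integral_const_mul, integral_Icc_eq_integral_Ioc,
    ← intervalIntegral.integral_of_le (by linarith), heightPairing]
  push_cast
  rw [show ((d : ℝ) + 1 - 3) / 2 = (d : ℝ) / 2 - 1 by ring, add_sub_cancel_right]

/-- The pairing of a derivative of the delta distribution on the hyperboloid with a power of the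
Euclidean norm, cut off at the height `h`. -/
theorem hasDeltaPairing_phaseBody {m : ℕ} (hm : 2 ≤ m) {h : ℝ} (hh : 0 < h) (j : ℕ) (C a : ℝ) :
    HasDeltaPairing j (phaseBody hm)
      (fun x => ((heightConstraints m hm h).map fun c => heaviside (-c x)).prod
        * (C * (‖x‖ ^ 2) ^ a))
      (C * (Real.pi ^ (((m : ℝ) - 1) / 2) / Real.Gamma (((m : ℝ) - 1) / 2))
        * ((-(lowerFst + lowerSnd)) ^ j)
          (fun a b => ∫ t in -h..h, (1 + 2 * t ^ 2) ^ a * (1 + t ^ 2) ^ b)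
          a (((m : ℝ) - 3) / 2)) := by
  intro ρ hρ hρs hρ1
  refine ((tendsto_lower_pow (fun a b =>
    tendsto_heightPairing (h := h) hρ.continuous hρs hρ1 a b) j a (((m : ℝ) - 3) / 2)).const_mul
    (C * (Real.pi ^ (((m : ℝ) - 1) / 2) / Real.Gamma (((m : ℝ) - 1) / 2)))).congr' ?_
  obtain ⟨R, hR0, hR⟩ : ∃ R, 0 < R ∧ tsupport ρ ⊆ Metric.ball 0 R := by
    obtain ⟨R, hR⟩ := hρs.isCompact.isBounded.subset_ball 0
    exact ⟨max R 1, by positivity, hR.trans (Metric.ball_subset_ball (le_max_left _ _))⟩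
  have hmem : Ioo (0 : ℝ) (1 / (4 * R)) ∈ 𝓝[>] (0 : ℝ) := Ioo_mem_nhdsGT (by positivity)
  filter_upwards [hmem] with ε hε
  have hε0 : 0 < ε := hε.1
  have hεR : R * ε < 1 / 4 := by
    have := (lt_div_iff₀ (by positivity)).mp hε.2
    linarith
  have hη : ContDiff ℝ ∞ fun t => ε⁻¹ * ρ (t / ε) :=
    contDiff_const.mul (hρ.comp (contDiff_id.div_const ε))
  -- The bound `1/4` on the support leaves room for its closure inside the open interval.
  have hs : tsupport (fun t => ε⁻¹ * ρ (t / ε)) ⊆ Ioo (-1 / 2) (1 / 2) := by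
    refine (closure_minimal (t := Icc (-1 / 4) (1 / 4)) ?_ isClosed_Icc).trans
      (Icc_subset_Ioo (by norm_num) (by norm_num))
    intro t ht
    have h1 : ρ (t / ε) ≠ 0 := right_ne_zero_of_mul ht
    have h2 := hR (subset_tsupport _ h1)
    rw [mem_ball_zero_iff, Real.norm_eq_abs, abs_div, abs_of_pos hε0, div_lt_iff₀ hε0] at h2
    have := abs_lt.mp (h2.trans hεR)
    exact ⟨by linarith [this.1], this.2.le⟩
  have hs' : ∀ j, tsupport (iteratedDeriv j fun t => ε⁻¹ * ρ (t / ε)) ⊆ Ioo (-1 / 2) (1 / 2) := by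
    intro j
    refine (closure_minimal (fun t ht => ?_) (isClosed_tsupport _)).trans hs
    exact support_iteratedFDeriv_subset (𝕜 := ℝ) j fun h0 => ht (by rw [iteratedDeriv, h0]; rfl)
  rw [integral_comp_phaseBody hm hh (hη.continuous_iteratedDeriv j (by exact_mod_cast le_top)) (hs' j),
    heightPairing_iteratedDeriv h j hη hs]

end SpaceIntegral

/-! ### Appell's function with parameters `a = 1/2`, `c = 3/2` -/

section Appell

open MeasureTheory Set

/-- The domain of the principal branch of Appell's function. -/
def appellDomain : Set (ℂ × ℂ) :=
  {z | 1 - z.1 ∈ Complex.slitPlane ∧ 1 - z.2 ∈ Complex.slitPlane}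

theorem isOpen_appellDomain : IsOpen appellDomain :=
  (Complex.isOpen_slitPlane.preimage (by fun_prop : Continuous fun z : ℂ × ℂ => 1 - z.1)).inter
    (Complex.isOpen_slitPlane.preimage (by fun_prop : Continuous fun z : ℂ × ℂ => 1 - z.2))

/-- The slit plane is star-shaped about `1`. This keeps Euler's integrand on the principal branch
for all `s` in `[0, 1]`. -/
theorem one_sub_mul_mem_slitPlane {w : ℂ} (hw : 1 - w ∈ Complex.slitPlane) {r : ℝ} (h0 : 0 ≤ r)
    (h1 : r ≤ 1) : 1 - w * r ∈ Complex.slitPlane := by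
  have := Complex.starConvex_one_slitPlane hw (sub_nonneg.mpr h1) h0 (by ring)
  convert this using 1
  simp only [Complex.real_smul]
  push_cast
  ring

/-- The identity theorem in one variable suffices: on the complex line through `0` and `z`, the
parameters staying in the domain form an open set, star-shaped about `0` and containing `1`. Near
`0` both functions are the sum of the same series. -/
theorem IsAppellF1.eqOn {a b₁ b₂ c : ℂ} {Φ Ψ : ℂ × ℂ → ℂ} (hΦ : IsAppellF1 a b₁ b₂ c Φ)
    (hΨ : IsAppellF1 a b₁ b₂ c Ψ) : EqOn Φ Ψ appellDomain := by
  intro z hz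
  set V : Set ℂ := {w | w • z ∈ appellDomain} with hV
  have hmaps : Continuous fun w : ℂ => w • z := by fun_prop
  have hVo : IsOpen V := isOpen_appellDomain.preimage hmaps
  have h0 : (0 : ℂ) ∈ V := by simp [hV, appellDomain]
  have hstar : StarConvex ℝ 0 V := by
    refine starConvex_zero_iff.mpr fun w hw t ht0 ht1 => ?_
    have e1 := one_sub_mul_mem_slitPlane hw.1 ht0 ht1
    have e2 := one_sub_mul_mem_slitPlane hw.2 ht0 ht1
    simp only [hV, appellDomain, mem_ofPred_eq, Prod.smul_fst, Prod.smul_snd, smul_eq_mul,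
      Complex.real_smul] at e1 e2 ⊢
    exact ⟨by convert e1 using 1; ring, by convert e2 using 1; ring⟩
  have hd : ∀ {Θ : ℂ × ℂ → ℂ}, IsAppellF1 a b₁ b₂ c Θ → AnalyticOnNhd ℂ (fun w : ℂ => Θ (w • z)) V :=
    fun hΘ => DifferentiableOn.analyticOnNhd
      (hΘ.1.comp (by fun_prop : Differentiable ℂ fun w : ℂ => w • z).differentiableOn
        fun w hw => hw) hVo
  have hev : (fun w : ℂ => Φ (w • z)) =ᶠ[𝓝 0] fun w : ℂ => Ψ (w • z) := by
    have hb : ∀ᶠ y : ℂ × ℂ in 𝓝 0, ‖y.1‖ < 1 ∧ ‖y.2‖ < 1 :=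
      ((isOpen_lt (by fun_prop) continuous_const).inter
        (isOpen_lt (by fun_prop) continuous_const)).mem_nhds
        (by simp : (0 : ℂ × ℂ) ∈ {y : ℂ × ℂ | ‖y.1‖ < 1} ∩ {y | ‖y.2‖ < 1})
    have ht : Filter.Tendsto (fun w : ℂ => w • z) (𝓝 0) (𝓝 0) := by
      simpa using hmaps.tendsto 0
    filter_upwards [ht.eventually hb] with w hw
    exact (hΦ.2 _ hw.1 hw.2).unique (hΨ.2 _ hw.1 hw.2)
  have := (hd hΦ).eqOn_of_preconnected_of_eventuallyEq (hd hΨ)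
    (hstar.isPathConnected h0).isConnected.isPreconnected h0 hev
    (show (1 : ℂ) ∈ V by simpa [hV] using hz)
  simpa using this

theorem IsAppellF1.appellF1_eq {a b₁ b₂ c : ℂ} {Φ : ℂ × ℂ → ℂ} (hΦ : IsAppellF1 a b₁ b₂ c Φ)
    {z : ℂ × ℂ} (hz : z ∈ appellDomain) : appellF1 a b₁ b₂ c z.1 z.2 = Φ z :=
  IsAppellF1.eqOn (Classical.epsilon_spec ⟨Φ, hΦ⟩) hΦ hz

/-- The two products telescope against each other. The quotient is the moment of `s ^ (2 N)` on `[0,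
1]`, which links Euler's integral to the coefficients of the double series. -/
theorem ascPochhammer_half_div (N : ℕ) :
    (ascPochhammer ℂ N).eval (1 / 2) / (ascPochhammer ℂ N).eval (3 / 2) = 1 / (2 * N + 1) := by
  have hne : ∀ k : ℕ, (2 * (k : ℂ) + 1) ≠ 0 := fun k => by norm_cast
  have key : (2 * (N : ℂ) + 1) * (ascPochhammer ℂ N).eval (1 / 2)
      = (ascPochhammer ℂ N).eval (3 / 2) ∧ (ascPochhammer ℂ N).eval (3 / 2) ≠ 0 := by
    induction N with
    | zero => simp
    | succ N ih =>
      rw [ascPochhammer_succ_eval, ascPochhammer_succ_eval, ← ih.1]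
      have h3 : (3 / 2 + N : ℂ) ≠ 0 := by
        have := hne (N + 1)
        push_cast at this
        intro h
        apply this
        linear_combination 2 * h
      refine ⟨by push_cast; ring, mul_ne_zero (ih.1 ▸ ih.2) h3⟩
  have hn := hne N
  rw [div_eq_div_iff key.2 hn, ← key.1]
  ring

/-- The binomial series. Absolute convergence is recorded so that two such series can be multiplied.
-/
theorem hasSum_one_sub_cpow_neg (b : ℂ) {w : ℂ} (hw : ‖w‖ < 1) :
    HasSum (fun k : ℕ => (ascPochhammer ℂ k).eval b / (k.factorial : ℂ) * w ^ k) ((1 - w) ^ (-b)) ∧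
      Summable fun k : ℕ => ‖(ascPochhammer ℂ k).eval b / (k.factorial : ℂ) * w ^ k‖ := by
  have h := Complex.one_div_one_sub_cpow_hasFPowerSeriesOnBall_zero b
  have hc : ∀ k : ℕ, Ring.choose (b + k - 1) k = (ascPochhammer ℂ k).eval b / (k.factorial : ℂ) := by
    intro k
    have := Ring.factorial_nsmul_multichoose_eq_ascPochhammer b k
    rw [Ring.multichoose_eq, Polynomial.ascPochhammer_smeval_cast,
      Polynomial.ascPochhammer_smeval_eq_eval, nsmul_eq_mul] at this
    rw [← this, mul_div_cancel_left₀ _ (by exact_mod_cast k.factorial_ne_zero)]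
  have hmem : w ∈ Metric.eball (0 : ℂ) 1 := by
    rw [mem_eball_zero_iff, ← ofReal_norm, ENNReal.ofReal_lt_one]
    exact hw
  have e : ∀ k : ℕ, (FormalMultilinearSeries.ofScalars ℂ (fun k : ℕ => Ring.choose (b + k - 1) k)) k
      (fun _ => w) = (ascPochhammer ℂ k).eval b / (k.factorial : ℂ) * w ^ k := fun k => by
    simp [FormalMultilinearSeries.ofScalars, hc]
  constructor
  · have := h.hasSum hmem
    simp only [e, zero_add, one_div, ← Complex.cpow_neg] at this
    exact this
  · have := FormalMultilinearSeries.summable_norm_apply _ (Metric.eball_subset_eball h.r_le hmem)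
    simpa only [e] using this

/-- The integrand of Euler's integral for Appell's function with `a = 1/2` and `c = 3/2`. -/
def appellIntegrand (b₁ b₂ : ℂ) (z : ℂ × ℂ) (s : ℝ) : ℂ :=
  (1 - z.1 * (s ^ 2 : ℝ)) ^ (-b₁) * (1 - z.2 * (s ^ 2 : ℝ)) ^ (-b₂)

/-- Euler's integral for Appell's function with `a = 1/2` and `c = 3/2`. -/
def appellIntegral (b₁ b₂ : ℂ) (z : ℂ × ℂ) : ℂ := ∫ s in (0 : ℝ)..1, appellIntegrand b₁ b₂ z s

/-- The terms of the expansion of Euler's integrand. -/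
def appellTerm (b₁ b₂ : ℂ) (z : ℂ × ℂ) (p : ℕ × ℕ) (s : ℝ) : ℂ :=
  (ascPochhammer ℂ p.1).eval b₁ / (p.1.factorial : ℂ) * (z.1 * (s ^ 2 : ℝ)) ^ p.1 *
    ((ascPochhammer ℂ p.2).eval b₂ / (p.2.factorial : ℂ) * (z.2 * (s ^ 2 : ℝ)) ^ p.2)

theorem norm_ofReal_sq_le_one {s : ℝ} (hs : s ∈ uIoc (0 : ℝ) 1) : ‖((s ^ 2 : ℝ) : ℂ)‖ ≤ 1 := by
  rw [uIoc_of_le zero_le_one] at hs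
  rw [Complex.norm_real, Real.norm_of_nonneg (sq_nonneg s)]
  nlinarith [hs.1, hs.2]

/-- Since `s² ≤ 1`, each term is bounded by its value at `s = 1`, and those values are absolutely
summable in the bidisc; dominated convergence exchanges sum and integral. -/
theorem hasSum_integral_appellTerm (b₁ b₂ : ℂ) {z : ℂ × ℂ} (h1 : ‖z.1‖ < 1) (h2 : ‖z.2‖ < 1) :
    HasSum (fun p => ∫ s in (0 : ℝ)..1, appellTerm b₁ b₂ z p s) (appellIntegral b₁ b₂ z) := by
  have hlt : ∀ {w : ℂ}, ‖w‖ < 1 → ∀ s ∈ uIoc (0 : ℝ) 1, ‖w * (s ^ 2 : ℝ)‖ < 1 := fun hw s hs => by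
    rw [norm_mul]
    exact (mul_le_of_le_one_right (norm_nonneg _) (norm_ofReal_sq_le_one hs)).trans_lt hw
  have hsum := (hasSum_one_sub_cpow_neg b₁ h1).2.mul_norm (hasSum_one_sub_cpow_neg b₂ h2).2
  refine intervalIntegral.hasSum_integral_of_dominated_convergence
    (fun p _ => ‖(ascPochhammer ℂ p.1).eval b₁ / (p.1.factorial : ℂ) * z.1 ^ p.1 *
      ((ascPochhammer ℂ p.2).eval b₂ / (p.2.factorial : ℂ) * z.2 ^ p.2)‖) ?_ ?_ ?_ ?_ ?_
  · exact fun p => Continuous.aestronglyMeasurable (by unfold appellTerm; fun_prop)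
  · refine fun p => Filter.Eventually.of_forall fun s hs => ?_
    have e : ∀ k : ℕ, ‖((s ^ 2 : ℝ) : ℂ) ^ k‖ ≤ 1 := fun k => by
      rw [norm_pow]
      exact pow_le_one₀ (norm_nonneg _) (norm_ofReal_sq_le_one hs)
    have heq : appellTerm b₁ b₂ z p s
        = (ascPochhammer ℂ p.1).eval b₁ / (p.1.factorial : ℂ) * z.1 ^ p.1 *
          ((ascPochhammer ℂ p.2).eval b₂ / (p.2.factorial : ℂ) * z.2 ^ p.2) *
          ((s ^ 2 : ℝ) : ℂ) ^ (p.1 + p.2) := by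
      rw [appellTerm, mul_pow, mul_pow, pow_add]; ring
    rw [heq, norm_mul]
    exact mul_le_of_le_one_right (norm_nonneg _) (e _)
  · exact Filter.Eventually.of_forall fun s _ => hsum
  · exact intervalIntegrable_const
  · refine Filter.Eventually.of_forall fun s hs => ?_
    have hs1 := hasSum_one_sub_cpow_neg b₁ (hlt h1 s hs)
    have hs2 := hasSum_one_sub_cpow_neg b₂ (hlt h2 s hs)
    have hm := summable_mul_of_summable_norm hs1.2 hs2.2
    have h3 := hs1.1.mul hs2.1 hm
    unfold appellTerm appellIntegrand
    exact h3

theorem integral_appellTerm (b₁ b₂ : ℂ) (z : ℂ × ℂ) (p : ℕ × ℕ) :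
    ∫ s in (0 : ℝ)..1, appellTerm b₁ b₂ z p s
      = (ascPochhammer ℂ (p.1 + p.2)).eval (1 / 2) * (ascPochhammer ℂ p.1).eval b₁ *
        (ascPochhammer ℂ p.2).eval b₂ /
        ((ascPochhammer ℂ (p.1 + p.2)).eval (3 / 2) * (p.1.factorial : ℂ) * (p.2.factorial : ℂ)) *
        z.1 ^ p.1 * z.2 ^ p.2 := by
  have heq : ∀ s, appellTerm b₁ b₂ z p s
      = (ascPochhammer ℂ p.1).eval b₁ / (p.1.factorial : ℂ) * z.1 ^ p.1 *
        ((ascPochhammer ℂ p.2).eval b₂ / (p.2.factorial : ℂ) * z.2 ^ p.2) *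
        ((s ^ (2 * (p.1 + p.2)) : ℝ) : ℂ) := fun s => by
    rw [appellTerm, mul_pow, mul_pow, pow_mul, pow_add]; push_cast; ring
  simp only [heq]
  rw [intervalIntegral.integral_const_mul, intervalIntegral.integral_ofReal, integral_pow]
  have h := ascPochhammer_half_div (p.1 + p.2)
  have e : (((1 ^ (2 * (p.1 + p.2) + 1) - 0 ^ (2 * (p.1 + p.2) + 1) : ℝ) /
      ((2 * (p.1 + p.2) : ℕ) + 1 : ℝ) : ℝ) : ℂ)
      = (ascPochhammer ℂ (p.1 + p.2)).eval (1 / 2) / (ascPochhammer ℂ (p.1 + p.2)).eval (3 / 2) := by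
    rw [h, one_pow, zero_pow (by omega)]
    push_cast
    ring
  rw [e]
  ring

theorem hasSum_appellIntegral (b₁ b₂ : ℂ) {z : ℂ × ℂ} (h1 : ‖z.1‖ < 1) (h2 : ‖z.2‖ < 1) :
    HasSum (fun p : ℕ × ℕ =>
      (ascPochhammer ℂ (p.1 + p.2)).eval (1 / 2) * (ascPochhammer ℂ p.1).eval b₁ *
        (ascPochhammer ℂ p.2).eval b₂ /
        ((ascPochhammer ℂ (p.1 + p.2)).eval (3 / 2) * (p.1.factorial : ℂ) * (p.2.factorial : ℂ)) *
        z.1 ^ p.1 * z.2 ^ p.2) (appellIntegral b₁ b₂ z) := by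
  simpa only [integral_appellTerm] using hasSum_integral_appellTerm b₁ b₂ h1 h2

/-! ### Holomorphy of Euler's integral -/

/-- The derivative of Euler's integrand in the variables of Appell's function. -/
def appellIntegrandDeriv (b₁ b₂ : ℂ) (z : ℂ × ℂ) (s : ℝ) : ℂ × ℂ →L[ℂ] ℂ :=
  (1 - z.1 * (s ^ 2 : ℝ)) ^ (-b₁) •
      (b₂ * (s ^ 2 : ℝ) * (1 - z.2 * (s ^ 2 : ℝ)) ^ (-b₂ - 1)) • ContinuousLinearMap.snd ℂ ℂ ℂ +
    (1 - z.2 * (s ^ 2 : ℝ)) ^ (-b₂) •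
      (b₁ * (s ^ 2 : ℝ) * (1 - z.1 * (s ^ 2 : ℝ)) ^ (-b₁ - 1)) • ContinuousLinearMap.fst ℂ ℂ ℂ

theorem hasFDerivAt_one_sub_cpow (b : ℂ) (L : ℂ × ℂ →L[ℂ] ℂ) {z : ℂ × ℂ}
    {s : ℝ} (hz : 1 - L z * (s ^ 2 : ℝ) ∈ Complex.slitPlane) :
    HasFDerivAt (fun z : ℂ × ℂ => (1 - L z * (s ^ 2 : ℝ)) ^ (-b))
      ((b * (s ^ 2 : ℝ) * (1 - L z * (s ^ 2 : ℝ)) ^ (-b - 1)) • L) z := by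
  have h : HasDerivAt (fun w : ℂ => (1 - w * (s ^ 2 : ℝ)) ^ (-b))
      (-b * (1 - L z * (s ^ 2 : ℝ)) ^ (-b - 1) * -(1 * (s ^ 2 : ℝ))) (L z) :=
    (((hasDerivAt_id (L z)).mul_const ((s ^ 2 : ℝ) : ℂ)).const_sub 1).cpow_const hz
  refine (h.comp_hasFDerivAt z L.hasFDerivAt).congr_fderiv ?_
  congr 1
  ring

theorem hasFDerivAt_appellIntegrand (b₁ b₂ : ℂ) {z : ℂ × ℂ} (hz : z ∈ appellDomain) {s : ℝ}
    (hs : s ∈ Icc (0 : ℝ) 1) :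
    HasFDerivAt (fun z => appellIntegrand b₁ b₂ z s) (appellIntegrandDeriv b₁ b₂ z s) z :=
  (hasFDerivAt_one_sub_cpow b₁ (ContinuousLinearMap.fst ℂ ℂ ℂ)
      (one_sub_mul_mem_slitPlane hz.1 (sq_nonneg _) (pow_le_one₀ hs.1 hs.2))).mul
    (hasFDerivAt_one_sub_cpow b₂ (ContinuousLinearMap.snd ℂ ℂ ℂ)
      (one_sub_mul_mem_slitPlane hz.2 (sq_nonneg _) (pow_le_one₀ hs.1 hs.2)))

theorem continuousOn_one_sub_fst_cpow (b : ℂ) :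
    ContinuousOn (fun p : (ℂ × ℂ) × ℝ => (1 - p.1.1 * (p.2 ^ 2 : ℝ)) ^ b)
      (appellDomain ×ˢ Icc 0 1) :=
  ContinuousOn.cpow (Continuous.continuousOn (by fun_prop)) continuousOn_const fun _ hp =>
    one_sub_mul_mem_slitPlane hp.1.1 (sq_nonneg _) (pow_le_one₀ hp.2.1 hp.2.2)

theorem continuousOn_one_sub_snd_cpow (b : ℂ) :
    ContinuousOn (fun p : (ℂ × ℂ) × ℝ => (1 - p.1.2 * (p.2 ^ 2 : ℝ)) ^ b)
      (appellDomain ×ˢ Icc 0 1) :=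
  ContinuousOn.cpow (Continuous.continuousOn (by fun_prop)) continuousOn_const fun _ hp =>
    one_sub_mul_mem_slitPlane hp.1.2 (sq_nonneg _) (pow_le_one₀ hp.2.1 hp.2.2)

theorem continuousOn_appellIntegrand (b₁ b₂ : ℂ) :
    ContinuousOn (fun p : (ℂ × ℂ) × ℝ => appellIntegrand b₁ b₂ p.1 p.2)
      (appellDomain ×ˢ Icc 0 1) :=
  (continuousOn_one_sub_fst_cpow _).mul (continuousOn_one_sub_snd_cpow _)

theorem continuousOn_appellIntegrandDeriv (b₁ b₂ : ℂ) :
    ContinuousOn (fun p : (ℂ × ℂ) × ℝ => appellIntegrandDeriv b₁ b₂ p.1 p.2)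
      (appellDomain ×ˢ Icc 0 1) := by
  have hsq : ∀ b : ℂ, ContinuousOn (fun p : (ℂ × ℂ) × ℝ => b * ((p.2 ^ 2 : ℝ) : ℂ))
    (appellDomain ×ˢ Icc 0 1) := fun b => Continuous.continuousOn (by fun_prop)
  exact ((continuousOn_one_sub_fst_cpow _).smul
      (((hsq _).mul (continuousOn_one_sub_snd_cpow _)).smul continuousOn_const)).add
    ((continuousOn_one_sub_snd_cpow _).smul
      (((hsq _).mul (continuousOn_one_sub_fst_cpow _)).smul continuousOn_const))

theorem continuousOn_appellIntegrand_slice (b₁ b₂ : ℂ) {z : ℂ × ℂ}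
    (hz : z ∈ appellDomain) : ContinuousOn (fun s => appellIntegrand b₁ b₂ z s) (Icc 0 1) := by
  have hm : MapsTo (fun s : ℝ => (z, s)) (Icc 0 1) (appellDomain ×ˢ Icc 0 1) :=
    fun s hs => ⟨hz, hs⟩
  have hc : ContinuousOn (fun s : ℝ => (z, s)) (Icc 0 1) := (Continuous.prodMk_right z).continuousOn
  have h := ContinuousOn.comp (f := fun s : ℝ => (z, s)) (continuousOn_appellIntegrand b₁ b₂) hc hm
  simpa only [Function.comp_def] using h

theorem continuousOn_appellIntegrandDeriv_slice (b₁ b₂ : ℂ) {z : ℂ × ℂ}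
    (hz : z ∈ appellDomain) : ContinuousOn (fun s => appellIntegrandDeriv b₁ b₂ z s) (Icc 0 1) := by
  have hm : MapsTo (fun s : ℝ => (z, s)) (Icc 0 1) (appellDomain ×ˢ Icc 0 1) :=
    fun s hs => ⟨hz, hs⟩
  have hc : ContinuousOn (fun s : ℝ => (z, s)) (Icc 0 1) := (Continuous.prodMk_right z).continuousOn
  have h := ContinuousOn.comp (f := fun s : ℝ => (z, s)) (continuousOn_appellIntegrandDeriv b₁ b₂) hc hm
  simpa only [Function.comp_def] using h

/-- Differentiation under the integral sign: on a closed ball in the domain times `[0, 1]`, a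
compact set, the continuous derivative of the integrand is bounded. -/
theorem differentiableOn_appellIntegral (b₁ b₂ : ℂ) :
    DifferentiableOn ℂ (appellIntegral b₁ b₂) appellDomain := by
  intro z₀ hz₀
  obtain ⟨r, hr0, hr⟩ := Metric.nhds_basis_closedBall.mem_iff.mp (isOpen_appellDomain.mem_nhds hz₀)
  obtain ⟨B, hB⟩ := ((isCompact_closedBall z₀ r).prod
    (isCompact_Icc (a := (0 : ℝ)) (b := 1))).exists_bound_of_continuousOn
    ((continuousOn_appellIntegrandDeriv b₁ b₂).mono (prod_mono hr Subset.rfl))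
  have hsub : uIoc (0 : ℝ) 1 ⊆ Icc 0 1 := by
    rw [uIoc_of_le zero_le_one]; exact Ioc_subset_Icc_self
  have hmain : HasFDerivAt (fun z => ∫ s in (0 : ℝ)..1, appellIntegrand b₁ b₂ z s)
      (∫ s in (0 : ℝ)..1, appellIntegrandDeriv b₁ b₂ z₀ s) z₀ := by
    refine intervalIntegral.hasFDerivAt_integral_of_dominated_of_fderiv_le
      (bound := fun _ => B) (Metric.closedBall_mem_nhds z₀ hr0) ?_ ?_ ?_ ?_ ?_ ?_
    · filter_upwards [Metric.closedBall_mem_nhds z₀ hr0] with z hz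
      exact ((continuousOn_appellIntegrand_slice b₁ b₂ (hr hz)).mono hsub).aestronglyMeasurable measurableSet_uIoc
    · refine ContinuousOn.intervalIntegrable ?_
      rw [uIcc_of_le zero_le_one]
      exact continuousOn_appellIntegrand_slice b₁ b₂ hz₀
    · exact ((continuousOn_appellIntegrandDeriv_slice b₁ b₂ hz₀).mono hsub).aestronglyMeasurable
        measurableSet_uIoc
    · exact Filter.Eventually.of_forall fun s hs z hz => hB (z, s) ⟨hz, hsub hs⟩
    · exact intervalIntegrable_const
    · exact Filter.Eventually.of_forall fun s hs z hz =>
        hasFDerivAt_appellIntegrand b₁ b₂ (hr hz) (hsub hs)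
  exact hmain.differentiableAt.differentiableWithinAt

theorem isAppellF1_appellIntegral (b₁ b₂ : ℂ) :
    IsAppellF1 (1 / 2) b₁ b₂ (3 / 2) (appellIntegral b₁ b₂) :=
  ⟨differentiableOn_appellIntegral b₁ b₂, fun _ h1 h2 => hasSum_appellIntegral b₁ b₂ h1 h2⟩

/-- The integrand is even, which gives the factor `2`; then `t = h s` turns half of the interval
into Euler's integral. -/
theorem integral_height_eq_appellF1 (h a b : ℝ) :
    ((∫ t in -h..h, (1 + 2 * t ^ 2) ^ a * (1 + t ^ 2) ^ b : ℝ) : ℂ)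
      = 2 * h * appellF1 (1 / 2) (-a) (-b) (3 / 2) (-2 * (h : ℂ) ^ 2) (-(h : ℂ) ^ 2) := by
  set f : ℝ → ℝ := fun t => (1 + 2 * t ^ 2) ^ a * (1 + t ^ 2) ^ b with hf
  have hfc : Continuous f := by
    refine Continuous.mul (Continuous.rpow_const (by fun_prop) fun t => Or.inl ?_)
      (Continuous.rpow_const (by fun_prop) fun t => Or.inl ?_)
    all_goals positivity
  have heven : ∫ t in -h..h, f t = 2 * ∫ t in (0 : ℝ)..h, f t := by
    rw [← intervalIntegral.integral_add_adjacent_intervals (b := 0)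
      (hfc.intervalIntegrable _ _) (hfc.intervalIntegrable _ _)]
    have : ∫ t in -h..0, f t = ∫ t in (0 : ℝ)..h, f t := by
      have := intervalIntegral.integral_comp_neg (a := 0) (b := h) f
      rw [neg_zero] at this
      rw [← this]
      simp [hf]
    rw [this, two_mul]
  have hscale : ∫ t in (0 : ℝ)..h, f t = h * ∫ s in (0 : ℝ)..1, f (h * s) := by
    have := intervalIntegral.smul_integral_comp_mul_left (a := 0) (b := 1) f h
    rw [mul_zero, mul_one, smul_eq_mul] at this
    exact this.symm
  have hz : ((-2 * (h : ℂ) ^ 2, -(h : ℂ) ^ 2) : ℂ × ℂ) ∈ appellDomain := by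
    have e1 : 1 - -2 * (h : ℂ) ^ 2 = ((1 + 2 * h ^ 2 : ℝ) : ℂ) := by push_cast; ring
    have e2 : 1 - -(h : ℂ) ^ 2 = ((1 + h ^ 2 : ℝ) : ℂ) := by push_cast; ring
    refine ⟨?_, ?_⟩
    · simp only [e1]; exact Complex.ofReal_mem_slitPlane.mpr (by positivity)
    · simp only [e2]; exact Complex.ofReal_mem_slitPlane.mpr (by positivity)
  have := (isAppellF1_appellIntegral (-a) (-b)).appellF1_eq hz
  rw [this, appellIntegral, heven, hscale]
  push_cast
  rw [mul_assoc, ← intervalIntegral.integral_ofReal]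
  congr 3
  ext s
  simp only [hf, appellIntegrand]
  rw [Complex.ofReal_mul, Complex.ofReal_cpow (by positivity), Complex.ofReal_cpow (by positivity)]
  push_cast
  congr 2 <;> ring

end Appell

/-! ### The area of the super-hyperboloid -/

theorem isAreaSH_eq (m n : ℕ) (hm : 2 ≤ m) {h : ℝ} (hh : 0 < h) :
    IsAreaSH m n hm h (2 * (Real.pi ^ n)⁻¹ *
      (Real.pi ^ (((m : ℝ) - 1) / 2) / Real.Gamma (((m : ℝ) - 1) / 2)) *
      (fallingCoeff n (((m : ℝ) - 3) / 2) *
        ∫ t in -h..h, (1 + 2 * t ^ 2) ^ (1 / 2 : ℝ) * (1 + t ^ 2) ^ (((m : ℝ) - 3) / 2 - n))) := by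
  refine ⟨isAdmissible_hyperboloid n hm h, fun A => ?_, fun j =>
    2 * (-1) ^ n * (Real.pi ^ n)⁻¹ * (n.choose j * fallingCoeff (n - j) (1 / 2)) *
      (Real.pi ^ (((m : ℝ) - 1) / 2) / Real.Gamma (((m : ℝ) - 1) / 2)) *
      ((-(lowerFst + lowerSnd)) ^ j)
        (fun a b => ∫ t in -h..h, (1 + 2 * t ^ 2) ^ a * (1 + t ^ 2) ^ b)
        (1 / 2 - ((n - j : ℕ) : ℝ)) (((m : ℝ) - 3) / 2), fun j hj => ?_, ?_⟩
  · by_cases hA : A = ∅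
    · subst hA
      rw [Pi.single_eq_same]
      exact contDiff_const
    · rw [Pi.single_eq_of_ne hA]
      exact contDiff_const
  · simp only [berezin_area_integrand n hm _ hj, hyperboloidPhase_empty]
    exact hasDeltaPairing_phaseBody hm hh j _ _
  · have hs := sum_choose_lower_apply n
      (fun a b => ∫ t in -h..h, (1 + 2 * t ^ 2) ^ a * (1 + t ^ 2) ^ b) (1 / 2) (((m : ℝ) - 3) / 2)
    -- The sign from the Berezin integral cancels the sign of `(-B) ^ n`.
    have h1 : ((-1 : ℝ) ^ n) * (-1) ^ n = 1 := by rw [← mul_pow]; norm_num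
    trans 2 * (-1) ^ n * (Real.pi ^ n)⁻¹ *
      (Real.pi ^ (((m : ℝ) - 1) / 2) / Real.Gamma (((m : ℝ) - 1) / 2)) *
      ((-1) ^ n * fallingCoeff n (((m : ℝ) - 3) / 2) *
        ∫ t in -h..h, (1 + 2 * t ^ 2) ^ (1 / 2 : ℝ) * (1 + t ^ 2) ^ (((m : ℝ) - 3) / 2 - n))
    · linear_combination (-(2 * (Real.pi ^ n)⁻¹ *
        (Real.pi ^ (((m : ℝ) - 1) / 2) / Real.Gamma (((m : ℝ) - 1) / 2)) *
        (fallingCoeff n (((m : ℝ) - 3) / 2) *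
        ∫ t in -h..h, (1 + 2 * t ^ 2) ^ (1 / 2 : ℝ) *
          (1 + t ^ 2) ^ (((m : ℝ) - 3) / 2 - n)))) * h1
    · rw [← hs, Finset.mul_sum]
      refine Finset.sum_congr rfl fun j _ => ?_
      ring

theorem fallingCoeff_eq_zero {n i : ℕ} (hi : i < n) : fallingCoeff n (i : ℝ) = 0 := by
  induction n with
  | zero => omega
  | succ n ih =>
    rw [fallingCoeff_succ]
    rcases Nat.lt_succ_iff_lt_or_eq.mp hi with h | h
    · rw [ih h, zero_mul]
    · rw [h, sub_self, mul_zero]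

/-- Repeated use of `Γ(x + 1) = x Γ(x)`; the hypothesis excludes exactly the zero factors of the
falling factorial. -/
theorem fallingCoeff_div_Gamma {n : ℕ} {p : ℝ} (hp : ∀ i < n, p ≠ i) :
    fallingCoeff n p / Real.Gamma (p + 1) = (Real.Gamma (p - n + 1))⁻¹ := by
  induction n with
  | zero => simp [fallingCoeff]
  | succ n ih =>
    have hne : p - n ≠ 0 := sub_ne_zero.mpr (hp n n.lt_succ_self)
    rw [fallingCoeff_succ, mul_div_right_comm, ih fun i hi => hp i (hi.trans n.lt_succ_self),
      Real.Gamma_add_one hne, mul_inv_rev, inv_mul_cancel_right₀ hne]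
    congr 2
    push_cast
    ring

end SuperAnalysis
end

theorem mainTheorem11 (m n : ℕ) (hm : 2 ≤ m) (h : ℝ) (hh : 0 < h) (M : ℤ)
    (hM : M = (m : ℤ) - 2 * (n : ℤ)) :
    ∃ S : ℝ, SuperAnalysis.IsAreaSH m n hm h S ∧
      ((¬ ∃ k : ℕ, 1 ≤ k ∧ M = -2 * (k : ℤ) + 3) →
        (∃ Φ, SuperAnalysis.IsAppellF1 (1 / 2) (-1 / 2) ((3 - (M : ℂ)) / 2) (3 / 2) Φ) ∧
        (S : ℂ) =
          ((4 * h * Real.pi ^ (((M : ℝ) - 1) / 2) / Real.Gamma (((M : ℝ) - 1) / 2) : ℝ) : ℂ) *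
            SuperAnalysis.appellF1 (1 / 2) (-1 / 2) ((3 - (M : ℂ)) / 2) (3 / 2)
              (-2 * (h : ℂ) ^ 2) (-(h : ℂ) ^ 2)) ∧
      ((∃ k : ℕ, 1 ≤ k ∧ M = -2 * (k : ℤ) + 3) → S = 0) := by
  have hMr : (M : ℝ) = m - 2 * n := by rw [hM]; push_cast; ring
  refine ⟨_, SuperAnalysis.isAreaSH_eq m n hm hh, fun hk => ⟨⟨_,
    SuperAnalysis.isAppellF1_appellIntegral _ _⟩, ?_⟩, ?_⟩
  -- An equality `(m - 3) / 2 = i` with `i < n` would make `M` exceptional, with `k = n - i`.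
  · have hp : ∀ i < n, ((m : ℝ) - 3) / 2 ≠ i := by
      intro i hi he
      refine hk ⟨n - i, by omega, ?_⟩
      have h1 : (m : ℝ) = 2 * i + 3 := by linarith
      have h2 : m = 2 * i + 3 := by exact_mod_cast h1
      omega
    have hG := SuperAnalysis.fallingCoeff_div_Gamma hp
    rw [show ((m : ℝ) - 3) / 2 + 1 = ((m : ℝ) - 1) / 2 by ring,
      show ((m : ℝ) - 3) / 2 - n + 1 = ((M : ℝ) - 1) / 2 by rw [hMr]; ring] at hG
    have hpi : Real.pi ^ (((M : ℝ) - 1) / 2) = Real.pi ^ (((m : ℝ) - 1) / 2) * (Real.pi ^ n)⁻¹ := by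
      rw [← Real.rpow_natCast, ← Real.rpow_neg Real.pi_pos.le, ← Real.rpow_add Real.pi_pos, hMr]
      congr 1
      ring
    have hI := SuperAnalysis.integral_height_eq_appellF1 h (1 / 2) (((m : ℝ) - 3) / 2 - n)
    have e1 : (-((1 / 2 : ℝ) : ℂ)) = -1 / 2 := by push_cast; ring
    have e2 : -((((m : ℝ) - 3) / 2 - n : ℝ) : ℂ) = (3 - (M : ℂ)) / 2 := by
      rw [hM]; push_cast; ring
    rw [e1, e2] at hI
    set I := ∫ t in -h..h, (1 + 2 * t ^ 2) ^ (1 / 2 : ℝ) * (1 + t ^ 2) ^ (((m : ℝ) - 3) / 2 - n)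
    have hS : 2 * (Real.pi ^ n)⁻¹ *
        (Real.pi ^ (((m : ℝ) - 1) / 2) / Real.Gamma (((m : ℝ) - 1) / 2)) *
        (SuperAnalysis.fallingCoeff n (((m : ℝ) - 3) / 2) * I)
        = 2 * Real.pi ^ (((M : ℝ) - 1) / 2) / Real.Gamma (((M : ℝ) - 1) / 2) * I := by
      rw [hpi, div_eq_mul_inv (2 * _), ← hG]
      ring
    rw [hS, Complex.ofReal_mul, hI]
    push_cast
    ring
  · rintro ⟨k, hk1, hk2⟩
    have hi : (m : ℤ) - 3 = 2 * (n - k) := by omega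
    -- From `m ≥ 2` and the parity in `hi`; hence `(m - 3) / 2` is the natural number `n - k`, less
    -- than `n`.
    have hkn : k ≤ n := by omega
    have hr : ((m : ℝ) - 3) / 2 = ((n - k : ℕ) : ℝ) := by
      rw [Nat.cast_sub hkn]
      have : (m : ℝ) - 3 = 2 * (n - k) := by exact_mod_cast hi
      rw [this]
      ring
    rw [hr, SuperAnalysis.fallingCoeff_eq_zero (by omega : n - k < n)]
    ring
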